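/- Let $\Omega\subset\mathbb R^d$ be compact with Lebesgue-null boundary, let $\Omega_c\subset\Omega$ be measurable, and let $\nu,\alpha,T>0$ and $y_0,y_{target}\in L^2(\Omega)$. Let $B:L^2(\Omega_c)\to L^2(\Omega)$ be extension by zero. Fix a homogeneous boundary condition, encoded by a closed subspace $V$ with $H^1_0(\Omega)\subseteq V\subseteq H^1(\Omega)$ ($V=H^1_0(\Omega)$: Dirichlet; $V=H^1(\Omega)$: Neumann). Here $H^1(\Omega)$ and $H^1_0(\Omega)$ refer to the interior of $\Omega$. For $\kappa\in\mathbb R$ and $S>0$, a solution of $\partial_t y-\kappa\Delta y=f$ on $[0,S]\times\Omega$ is a function $y\in C([0,S];L^2(\Omega))\cap L^2(0,S;V)$ such that, for all $w\in V$ and $t\in[0,S]$, $$(y(t),w)-(y(0),w)+\kappa\int_0^t(\nabla y(s),\nabla w)\,ds=\int_0^t(f(s),w)\,ds .$$ For $S>0$, $v\in\mathcal H_S:=L^2([0,S];L^2(\Omega_c))$, the state of $v$ on $[0,S]$ is the solution $y$ of $\partial_t y-\nu\Delta y=Bv$ with $y(0)=y_0$. Let $v^*\in\mathcal H_T$ be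 an optimal control, that is, a minimizer over $\mathcal H_T$ of $$J(v)=\tfrac12\|y(T)-y_{target}\|^2_{L^2(\Omega)}+\tfrac\alpha2\|v\|^2_{\mathcal H_T},$$ where $y$ is the state of $v$. Let $y^*$ be the state of $v^*$, let $p^*$ be its adjoint state, i.e. the solution of $\partial_t p+\nu\Delta p=0$ on $[0,T]\times\Omega$ with $p(T)=y^*(T)-y_{target}$, and let $\chi^*=y^*-p^*$ be the target trajectory. Let $\tau\in\,]0,T[$. Then every $w\in\mathcal H_\tau$ has exactly one state $y$ on $[0,\tau]$, and the functional $$J_\tau(w)=\tfrac12\|y(\tau)-\chi^*(\tau)\|^2_{L^2(\Omega)}+\tfrac\alpha2\|w\|^2_{\mathcal H_\tau},\qquad w\in\mathcal H_\tau,$$ has exactly one minimizer over $\mathcal H_\tau$, namely the restriction $v^*_{|[0,\tau]}$. -/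

import Mathlib

open MeasureTheory Set
open scoped ContDiff

/-- The real Hilbert space `L²(Ω)` for Lebesgue measure, `Ω ⊆ ℝᵈ`. -/
abbrev L2 {d : ℕ} (Ω : Set (EuclideanSpace ℝ (Fin d))) : Type :=
  Lp ℝ 2 (volume.restrict Ω)

/-- The real Hilbert space `L²(Ω; ℝᵈ)`. -/
abbrev L2Vec {d : ℕ} (Ω : Set (EuclideanSpace ℝ (Fin d))) : Type :=
  Lp (EuclideanSpace ℝ (Fin d)) 2 (volume.restrict Ω)

/-- Pairs `(u, g)` in `L²(Ω) × L²(Ω; ℝᵈ)` with the Hilbert norm `(‖u‖² + ‖g‖²)^(1/2)`. An element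
`u` of `H¹(Ω)` is represented by the pair `(u, ∇u)`, so that this norm is the `H¹` norm. -/
abbrev GradPair {d : ℕ} (Ω : Set (EuclideanSpace ℝ (Fin d))) : Type :=
  WithLp 2 (L2 Ω × L2Vec Ω)

/-- Test functions: smooth functions with compact support in the interior of `Ω`. -/
def IsTestFunction {d : ℕ} (Ω : Set (EuclideanSpace ℝ (Fin d)))
    (φ : EuclideanSpace ℝ (Fin d) → ℝ) : Prop :=
  ContDiff ℝ ∞ φ ∧ HasCompactSupport φ ∧ tsupport φ ⊆ interior Ω

/-- `g` is the weak (distributional) gradient of `u` in the interior of `Ω`. -/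
def HasWeakGradient {d : ℕ} (Ω : Set (EuclideanSpace ℝ (Fin d))) (u : L2 Ω) (g : L2Vec Ω) : Prop :=
  ∀ φ : EuclideanSpace ℝ (Fin d) → ℝ, IsTestFunction Ω φ → ∀ e : EuclideanSpace ℝ (Fin d),
    ∫ x in Ω, u x * fderiv ℝ φ x e = - ∫ x in Ω, inner ℝ (g x) e * φ x

/-- `V` is a closed subspace of `H¹(Ω)` that contains the test functions, i.e. a closed subspace
with `H¹₀(Ω) ⊆ V ⊆ H¹(Ω)`. Such a space encodes the homogeneous boundary condition:
`V = H¹₀(Ω)` is the Dirichlet condition, `V = H¹(Ω)` the Neumann condition, and the spaces between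
them contain mixed and (on a box) periodic conditions. -/
structure IsEnergySpace {d : ℕ} (Ω : Set (EuclideanSpace ℝ (Fin d)))
    (V : Submodule ℝ (GradPair Ω)) : Prop where
  hasWeakGradient : ∀ U ∈ V, HasWeakGradient Ω U.fst U.snd
  isClosed : IsClosed (V : Set (GradPair Ω))
  testFunction_mem : ∀ φ : EuclideanSpace ℝ (Fin d) → ℝ, IsTestFunction Ω φ →
    ∃ U ∈ V, (U.fst =ᵐ[volume.restrict Ω] φ) ∧ (U.snd =ᵐ[volume.restrict Ω] gradient φ)

/-- `y` is a weak solution of `∂ₜ y - κ Δ y = f` on `[0, T] × Ω` with the boundary condition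
encoded by `V`: `y ∈ C([0, T]; L²(Ω)) ∩ L²(0, T; V)` and, for every `w ∈ V`,
`d/dt (y, w) + κ (∇y, ∇w) = (f, w)` in the time-integrated form. The function `Y` is `t ↦ (y(t), ∇y(t))`.
Only the values of `y` and `f` on `[0, T]` matter. -/
def IsWeakSolution {d : ℕ} {Ω : Set (EuclideanSpace ℝ (Fin d))} (V : Submodule ℝ (GradPair Ω))
    (κ T : ℝ) (f y : ℝ → L2 Ω) : Prop :=
  ContinuousOn y (Icc 0 T) ∧
  ∃ Y : ℝ → GradPair Ω,
    MemLp Y 2 (volume.restrict (Icc 0 T)) ∧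
    (∀ᵐ t ∂(volume.restrict (Icc 0 T)), Y t ∈ V ∧ (Y t).fst = y t) ∧
    ∀ w ∈ V, ∀ t ∈ Icc 0 T,
      inner ℝ (y t) w.fst - inner ℝ (y 0) w.fst + κ * (∫ s in (0 : ℝ)..t, inner ℝ (Y s).snd w.snd)
        = ∫ s in (0 : ℝ)..t, inner ℝ (f s) w.fst

/-- The space of controls `L²([0, T]; L²(Ωc))`. -/
abbrev Control {d : ℕ} (Ωc : Set (EuclideanSpace ℝ (Fin d))) (T : ℝ) : Type :=
  Lp (L2 Ωc) 2 (volume.restrict (Icc (0 : ℝ) T))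

/-- The injection `B` of `L²(Ωc)` into `L²(Ω)`: extension by zero. -/
noncomputable def injection {d : ℕ} (Ω : Set (EuclideanSpace ℝ (Fin d)))
    {Ωc : Set (EuclideanSpace ℝ (Fin d))} (hc : MeasurableSet Ωc) (u : L2 Ωc) : L2 Ω :=
  MemLp.toLp (Ωc.indicator u) (((memLp_indicator_iff_restrict hc).2 (Lp.memLp u)).restrict Ω)

/-- The restriction of a control on `[0, T]` to `[0, τ]`. -/
noncomputable def Control.restrict {d : ℕ} {Ωc : Set (EuclideanSpace ℝ (Fin d))} {τ T : ℝ}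
    (h : τ ≤ T) (v : Control Ωc T) : Control Ωc τ :=
  MemLp.toLp (fun t => v t)
    ((Lp.memLp v).mono_measure (Measure.restrict_mono (Icc_subset_Icc_right h) le_rfl))

/-- `y` is the state of the control `v` on `[0, T]`: `∂ₜ y - ν Δ y = B v`, `y(0) = y₀`. -/
def IsState {d : ℕ} {Ω Ωc : Set (EuclideanSpace ℝ (Fin d))} (V : Submodule ℝ (GradPair Ω))
    (hc : MeasurableSet Ωc) (ν : ℝ) (y₀ : L2 Ω) (T : ℝ) (v : Control Ωc T) (y : ℝ → L2 Ω) : Prop :=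
  IsWeakSolution V ν T (fun t => injection Ω hc (v t)) y ∧ y 0 = y₀

/-- `p` is the adjoint state on `[0, T]` with final value `q`: `∂ₜ p + ν Δ p = 0`, `p(T) = q`. -/
def IsAdjointState {d : ℕ} {Ω : Set (EuclideanSpace ℝ (Fin d))} (V : Submodule ℝ (GradPair Ω))
    (ν T : ℝ) (q : L2 Ω) (p : ℝ → L2 Ω) : Prop :=
  IsWeakSolution V (-ν) T (fun _ => 0) p ∧ p T = q

/-- The cost `½ ‖y(T) - z‖² + (α/2) ‖v‖²` of a control `v` with state `y`, for the target `z`. -/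
noncomputable def cost {d : ℕ} {Ω Ωc : Set (EuclideanSpace ℝ (Fin d))} (α T : ℝ) (z : L2 Ω)
    (v : Control Ωc T) (y : ℝ → L2 Ω) : ℝ :=
  1 / 2 * ‖y T - z‖ ^ 2 + α / 2 * ‖v‖ ^ 2

/-- The control `v` minimizes, over all controls on `[0, T]`, the cost with target `z` of a control
and its state with initial value `y₀`. -/
def IsOptimalControl {d : ℕ} {Ω Ωc : Set (EuclideanSpace ℝ (Fin d))}
    (V : Submodule ℝ (GradPair Ω)) (hc : MeasurableSet Ωc) (ν α : ℝ) (y₀ : L2 Ω) (T : ℝ)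
    (z : L2 Ω) (v : Control Ωc T) : Prop :=
  ∃ y : ℝ → L2 Ω, IsState V hc ν y₀ T v y ∧
    ∀ (w : Control Ωc T) (x : ℝ → L2 Ω), IsState V hc ν y₀ T w x →
      cost α T z v y ≤ cost α T z w x

/-- The target trajectory `χ = y - p`. -/
noncomputable def targetTrajectory {d : ℕ} {Ω : Set (EuclideanSpace ℝ (Fin d))}
    (y p : ℝ → L2 Ω) : ℝ → L2 Ω :=
  fun t => y t - p t

/-! The target trajectory is built so that `y τ - χ τ = p τ`. Take a direction `h` on `[0, τ]`,
extend it by zero to `k` on `[0, T]`, and let `x` be the state of `k` with initial value `0`.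
Duality says `d/dt (p, x) = (p, B k)`, and `k` vanishes after `τ`, so `(p τ, x τ) = (p T, x T) = (y
T - y_target, x T)`. Hence the first-order condition of the full problem in the direction `k` is
also that of the restricted problem at `v*|[0, τ]` in the direction `h`: `(p τ, x τ) + α (v*, h) =
0` (`exists_isState_inner_adjoint_add_inner_restrict`). The cost being quadratic, its excess at `v*
+ h` is exactly `½ ‖x τ‖² + α/2 ‖h‖²` (`exists_isState_cost_eq`), which gives both minimality and
uniqueness.

What remains is the theory of weak solutions, done for an abstract form `(G a, G b)` on `W` with `i
: W → H` and `(i a, i b) + (G a, G b) = (a, b)`. Put `R = i i† = (1 + A)⁻¹`. For a primitive `u` of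
an `L²` function, `R u` is an explicit solution, and its energy identity and its duality with
adjoint solutions are product rules for primitives. The energy estimate makes the set of data
reached by limits of such solutions closed, and an orthogonality argument shows that it contains all
data (`exists_mem_closure_regularSolutions`). The weak equation and the duality pass to the limit
(`exists_isFormSolution`). Uniqueness (`IsFormSolution.eqOn`) has a separate proof. -/

/-! ### Product rule for primitives of integrable functions. -/

section Primitive

variable {E : Type*} [NormedAddCommGroup E] [InnerProductSpace ℝ E] [CompleteSpace E]

theorem setIntegral_Ioc_indicator_Iic {F : Type*} [NormedAddCommGroup F] [NormedSpace ℝ F]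
    (b : ℝ → F) {s t : ℝ} (hs : s ∈ Ioc 0 t) :
    ∫ r in Ioc 0 t, (Iic s).indicator b r = ∫ r in (0 : ℝ)..s, b r := by
  rw [setIntegral_indicator measurableSet_Iic, Ioc_inter_Iic, min_eq_right hs.2,
    intervalIntegral.integral_of_le hs.1.le]

/-- The strict version serves the complement of the closed triangle `r ≤ s` in the Fubini argument
below. -/
theorem setIntegral_Ioc_indicator_Iio {F : Type*} [NormedAddCommGroup F] [NormedSpace ℝ F]
    (b : ℝ → F) {s t : ℝ} (hs : s ∈ Ioc 0 t) :
    ∫ r in Ioc 0 t, (Iio s).indicator b r = ∫ r in (0 : ℝ)..s, b r := by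
  rw [← setIntegral_Ioc_indicator_Iic b hs]
  refine integral_congr_ae (ae_restrict_of_ae ?_)
  exact indicator_ae_eq_of_ae_eq_set Iio_ae_eq_Iic

/-- Integration by parts for the primitives of two integrable functions. -/
theorem integral_inner_primitive {a b : ℝ → E} {t : ℝ} (ht : 0 ≤ t)
    (ha : IntervalIntegrable a volume 0 t) (hb : IntervalIntegrable b volume 0 t) :
    (IntervalIntegrable (fun s => inner ℝ (a s) (∫ r in (0 : ℝ)..s, b r)) volume 0 t ∧
      IntervalIntegrable (fun s => inner ℝ (∫ r in (0 : ℝ)..s, a r) (b s)) volume 0 t) ∧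
    (∫ s in (0 : ℝ)..t, inner ℝ (a s) (∫ r in (0 : ℝ)..s, b r))
      + (∫ s in (0 : ℝ)..t, inner ℝ (∫ r in (0 : ℝ)..s, a r) (b s))
      = inner ℝ (∫ s in (0 : ℝ)..t, a s) (∫ s in (0 : ℝ)..t, b s) := by
  simp only [intervalIntegrable_iff_integrableOn_Ioc_of_le ht] at *
  simp only [intervalIntegral.integral_of_le ht]
  set μ : Measure ℝ := volume.restrict (Ioc 0 t) with hμ
  have hF : Integrable (fun z : ℝ × ℝ => (inner ℝ (a z.1) (b z.2) : ℝ)) (μ.prod μ) :=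
    Integrable.op_fst_snd (op := fun x y : E => (inner ℝ x y : ℝ)) (continuous_inner (𝕜 := ℝ))
      ⟨1, fun x y => by simpa using norm_inner_le_norm (𝕜 := ℝ) x y⟩ ha hb
  -- The square `(0, t]²` is cut along its diagonal; Fubini on each half, in opposite orders, gives
  -- the two integrals on the left.
  have hm : MeasurableSet {z : ℝ × ℝ | z.2 ≤ z.1} := measurableSet_le measurable_snd measurable_fst
  have h1 := hF.indicator hm
  have h2 := hF.indicator hm.compl
  have e1 : (fun s => ∫ r, {z : ℝ × ℝ | z.2 ≤ z.1}.indicator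
      (fun z : ℝ × ℝ => (inner ℝ (a z.1) (b z.2) : ℝ)) (s, r) ∂μ)
      =ᵐ[μ] fun s => inner ℝ (a s) (∫ r in (0 : ℝ)..s, b r) := by
    filter_upwards [ae_restrict_mem measurableSet_Ioc] with s hs
    rw [← setIntegral_Ioc_indicator_Iic b hs, ← integral_inner (hb.indicator measurableSet_Iic)]
    refine integral_congr_ae (ae_of_all _ fun r => ?_)
    by_cases h : r ≤ s <;> simp [indicator, h]
  have e2 : (fun r => ∫ s, {z : ℝ × ℝ | z.2 ≤ z.1}ᶜ.indicator
      (fun z : ℝ × ℝ => (inner ℝ (a z.1) (b z.2) : ℝ)) (s, r) ∂μ)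
      =ᵐ[μ] fun r => inner ℝ (∫ s in (0 : ℝ)..r, a s) (b r) := by
    filter_upwards [ae_restrict_mem measurableSet_Ioc] with r hr
    rw [← setIntegral_Ioc_indicator_Iio a hr, real_inner_comm,
      ← integral_inner (ha.indicator measurableSet_Iio)]
    refine integral_congr_ae (ae_of_all _ fun s => ?_)
    by_cases h : s < r
    · simp [indicator, h, real_inner_comm]
    · simp [indicator, h, not_lt.1 h]
  refine ⟨⟨h1.integral_prod_left.congr e1, h2.integral_prod_right.congr e2⟩, ?_⟩
  have s1 := integral_prod _ h1
  have s2 := integral_prod_symm _ h2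
  rw [integral_congr_ae e1] at s1
  rw [integral_congr_ae e2] at s2
  rw [← s1, ← s2, ← integral_add h1 h2]
  have : ∀ z, {z : ℝ × ℝ | z.2 ≤ z.1}.indicator
      (fun z : ℝ × ℝ => (inner ℝ (a z.1) (b z.2) : ℝ)) z + {z : ℝ × ℝ | z.2 ≤ z.1}ᶜ.indicator
      (fun z : ℝ × ℝ => (inner ℝ (a z.1) (b z.2) : ℝ)) z = inner ℝ (a z.1) (b z.2) :=
    fun z => congrFun (indicator_self_add_compl _ _) z
  simp only [this]
  rw [integral_prod _ hF]
  rw [real_inner_comm, ← integral_inner ha]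
  refine integral_congr_ae (ae_of_all _ fun s => ?_)
  simpa only [real_inner_comm (a s)] using integral_inner hb (a s)

/-- The product rule, in integrated form, for the inner product of two primitives. -/
theorem integral_inner_add_integral_inner {a b u w : ℝ → E} {t : ℝ} (ht : 0 ≤ t)
    (ha : IntervalIntegrable a volume 0 t) (hb : IntervalIntegrable b volume 0 t)
    (hu : ∀ s ∈ Icc 0 t, u s = u 0 + ∫ r in (0 : ℝ)..s, a r)
    (hw : ∀ s ∈ Icc 0 t, w s = w 0 + ∫ r in (0 : ℝ)..s, b r) :
    (IntervalIntegrable (fun s => inner ℝ (a s) (w s)) volume 0 t ∧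
      IntervalIntegrable (fun s => inner ℝ (u s) (b s)) volume 0 t) ∧
    (∫ s in (0 : ℝ)..t, inner ℝ (a s) (w s)) + (∫ s in (0 : ℝ)..t, inner ℝ (u s) (b s))
      = inner ℝ (u t) (w t) - inner ℝ (u 0) (w 0) := by
  obtain ⟨⟨i1, i2⟩, h⟩ := integral_inner_primitive ht ha hb
  have j1 : IntervalIntegrable (fun s => (inner ℝ (a s) (w 0) : ℝ)) volume 0 t :=
    ⟨ha.1.inner_const _, ha.2.inner_const _⟩
  have j2 : IntervalIntegrable (fun s => (inner ℝ (u 0) (b s) : ℝ)) volume 0 t :=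
    ⟨hb.1.const_inner _, hb.2.const_inner _⟩
  have e1 : EqOn (fun s => (inner ℝ (a s) (w 0) : ℝ) + inner ℝ (a s) (∫ r in (0 : ℝ)..s, b r))
      (fun s => inner ℝ (a s) (w s)) (uIcc 0 t) := by
    intro s hs
    rw [uIcc_of_le ht] at hs
    simp only [hw s hs, inner_add_right]
  have e2 : EqOn (fun s => (inner ℝ (u 0) (b s) : ℝ) + inner ℝ (∫ r in (0 : ℝ)..s, a r) (b s))
      (fun s => inner ℝ (u s) (b s)) (uIcc 0 t) := by
    intro s hs
    rw [uIcc_of_le ht] at hs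
    simp only [hu s hs, inner_add_left]
  refine ⟨⟨(j1.add i1).congr (e1.mono uIoc_subset_uIcc), (j2.add i2).congr (e2.mono uIoc_subset_uIcc)⟩, ?_⟩
  rw [← intervalIntegral.integral_congr e1, ← intervalIntegral.integral_congr e2,
    intervalIntegral.integral_add j1 i1, intervalIntegral.integral_add j2 i2]
  have k1 : (∫ s in (0 : ℝ)..t, (inner ℝ (a s) (w 0) : ℝ))
      = inner ℝ (∫ s in (0 : ℝ)..t, a s) (w 0) := by
    simp only [intervalIntegral.integral_of_le ht]
    rw [real_inner_comm, ← integral_inner ha.1]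
    simp only [real_inner_comm]
  have k2 : (∫ s in (0 : ℝ)..t, (inner ℝ (u 0) (b s) : ℝ))
      = inner ℝ (u 0) (∫ s in (0 : ℝ)..t, b s) := by
    simp only [intervalIntegral.integral_of_le ht]
    rw [← integral_inner hb.1]
  rw [hu t ⟨ht, le_rfl⟩, hw t ⟨ht, le_rfl⟩, k1, k2]
  simp only [inner_add_left, inner_add_right]
  linarith

end Primitive

/-! ### Abstract weak solutions and their uniqueness. -/

section EvolutionEquation

variable {H W K : Type*} [NormedAddCommGroup H] [InnerProductSpace ℝ H]
  [NormedAddCommGroup W] [InnerProductSpace ℝ W]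
  [NormedAddCommGroup K] [InnerProductSpace ℝ K]

/-- Weak solutions of `y' + κ A y = f` on `[0, S]` for the operator `A` of the form
`(G y, G w)` on the form domain `i : W → H`; `Y` is `y` seen in the form domain. -/
structure IsFormSolution (i : W →L[ℝ] H) (G : W →L[ℝ] K) (κ S : ℝ) (f y : ℝ → H) (Y : ℝ → W) :
    Prop where
  continuousOn : ContinuousOn y (Icc 0 S)
  memLp : MemLp Y 2 (volume.restrict (Icc 0 S))
  ae_eq : ∀ᵐ t ∂(volume.restrict (Icc 0 S)), i (Y t) = y t
  weak_eq : ∀ w, ∀ t ∈ Icc 0 S,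
    inner ℝ (y t) (i w) - inner ℝ (y 0) (i w) + κ * (∫ s in (0 : ℝ)..t, inner ℝ (G (Y s)) (G w))
      = ∫ s in (0 : ℝ)..t, inner ℝ (f s) (i w)

theorem MeasureTheory.MemLp.intervalIntegrable_of_mem_Icc {E : Type*} [NormedAddCommGroup E]
    {S t : ℝ} {f : ℝ → E}
    (hf : MemLp f 2 (volume.restrict (Icc 0 S))) (ht : t ∈ Icc 0 S) :
    IntervalIntegrable f volume 0 t := by
  rw [intervalIntegrable_iff_integrableOn_Icc_of_le ht.1]
  have : IntegrableOn f (Icc 0 S) := hf.integrable one_le_two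
  exact this.mono_set (Icc_subset_Icc_right ht.2)

theorem intervalIntegral_inner_right [CompleteSpace H] {a : ℝ → H} {t : ℝ} (ht : 0 ≤ t)
    (ha : IntervalIntegrable a volume 0 t) (c : H) :
    ∫ s in (0 : ℝ)..t, (inner ℝ (a s) c : ℝ) = inner ℝ (∫ s in (0 : ℝ)..t, a s) c := by
  simp only [intervalIntegral.integral_of_le ht]
  rw [real_inner_comm, ← integral_inner ha.1]
  simp only [real_inner_comm]

/-- Weak solutions are determined by their initial value and source. -/
theorem IsFormSolution.eqOn [CompleteSpace K] {i : W →L[ℝ] H} {G : W →L[ℝ] K}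
    {κ S : ℝ} (hκ : 0 < κ) (hS : 0 < S)
    {f y y' : ℝ → H} {Y Y' : ℝ → W} (h : IsFormSolution i G κ S f y Y)
    (h' : IsFormSolution i G κ S f y' Y') (h0 : y 0 = y' 0) : EqOn y y' (Icc 0 S) := by
  have hS' : S ∈ Icc 0 S := ⟨hS.le, le_rfl⟩
  set a : ℝ → K := fun s => G (Y s - Y' s) with ha_def
  have ha : MemLp a 2 (volume.restrict (Icc 0 S)) := (h.memLp.sub h'.memLp).continuousLinearMap_comp G
  have hsum : ∀ w, ∀ t ∈ Icc 0 S,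
      inner ℝ (y t - y' t) (i w) + κ * inner ℝ (∫ s in (0 : ℝ)..t, a s) (G w) = 0 := by
    intro w t ht
    have e1 := h.weak_eq w t ht
    have e2 := h'.weak_eq w t ht
    have m1 := ((h.memLp.continuousLinearMap_comp G).intervalIntegrable_of_mem_Icc ht)
    have m2 := ((h'.memLp.continuousLinearMap_comp G).intervalIntegrable_of_mem_Icc ht)
    rw [intervalIntegral_inner_right ht.1 m1] at e1
    rw [intervalIntegral_inner_right ht.1 m2] at e2
    simp only [ha_def, map_sub, intervalIntegral.integral_sub m1 m2, inner_sub_left]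
    rw [h0] at e1
    linarith
  obtain ⟨⟨i1, i2⟩, hibp⟩ := integral_inner_primitive hS.le (ha.intervalIntegrable_of_mem_Icc hS')
    (ha.intervalIntegrable_of_mem_Icc hS')
  -- The equation is already integrated in time, so for almost every `t` it may be tested with `Y t
  -- - Y' t` itself.
  have hae : ∀ᵐ t ∂(volume.restrict (Icc 0 S)),
      ‖y t - y' t‖ ^ 2 = -κ * inner ℝ (∫ s in (0 : ℝ)..t, a s) (a t) := by
    filter_upwards [h.ae_eq, h'.ae_eq, ae_restrict_mem measurableSet_Icc] with t h1 h2 ht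
    have := hsum (Y t - Y' t) t ht
    rw [map_sub, h1, h2, real_inner_self_eq_norm_sq] at this
    simp only [ha_def] at *
    linarith
  have hint : Integrable (fun t => ‖y t - y' t‖ ^ 2) (volume.restrict (Icc 0 S)) := by
    have : IntegrableOn (fun t => -κ * (inner ℝ (∫ s in (0 : ℝ)..t, a s) (a t) : ℝ)) (Icc 0 S) :=
      ((intervalIntegrable_iff_integrableOn_Icc_of_le hS.le).1 i2).const_mul _
    exact Integrable.congr this (hae.mono fun t ht => ht.symm)
  have hle : ∫ t in Icc 0 S, ‖y t - y' t‖ ^ 2 ≤ 0 := by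
    rw [integral_congr_ae hae, integral_const_mul, integral_Icc_eq_integral_Ioc,
      ← intervalIntegral.integral_of_le hS.le]
    -- By the product rule the right side of `hae` integrates to `-(κ/2) ‖∫ a‖²`, which is
    -- nonpositive.
    have hcomm : ∫ s in (0 : ℝ)..S, (inner ℝ (a s) (∫ r in (0 : ℝ)..s, a r) : ℝ)
        = ∫ s in (0 : ℝ)..S, inner ℝ (∫ r in (0 : ℝ)..s, a r) (a s) := by
      simp only [real_inner_comm]
    rw [hcomm, real_inner_self_eq_norm_sq] at hibp
    nlinarith [sq_nonneg ‖∫ s in (0 : ℝ)..S, a s‖]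
  have hzero := (integral_eq_zero_iff_of_nonneg (fun t => sq_nonneg ‖y t - y' t‖) hint).1
    (le_antisymm hle (integral_nonneg fun t => sq_nonneg _))
  refine Measure.eqOn_Icc_of_ae_eq volume hS.ne ?_ h.continuousOn h'.continuousOn
  filter_upwards [hzero] with t ht
  exact sub_eq_zero.1 (norm_eq_zero.1 (pow_eq_zero_iff two_ne_zero |>.1 ht))

end EvolutionEquation

/-! ### Explicit solutions obtained by applying the resolvent to primitives. -/

section RegularSolutions

variable {H W K : Type*} [NormedAddCommGroup H] [InnerProductSpace ℝ H] [CompleteSpace H]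
  [NormedAddCommGroup W] [InnerProductSpace ℝ W] [CompleteSpace W]
  [NormedAddCommGroup K] [InnerProductSpace ℝ K]

/-- The primitive of `g` with value `u₀` at `0`. -/
noncomputable def primitive (u₀ : H) (g : ℝ → H) (t : ℝ) : H :=
  u₀ + ∫ s in (0 : ℝ)..t, g s

/-- The resolvent `(1 + A)⁻¹ = i i†`. -/
noncomputable def formResolvent (i : W →L[ℝ] H) : H →L[ℝ] H :=
  i ∘L ContinuousLinearMap.adjoint i

/-- The source for which `(1 + A)⁻¹ u` solves the evolution equation, where `u' = g`. -/
noncomputable def regularSource (i : W →L[ℝ] H) (κ : ℝ) (u₀ : H) (g : ℝ → H) (t : ℝ) : H :=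
  formResolvent i (g t) + κ • (primitive u₀ g t - formResolvent i (primitive u₀ g t))

omit [CompleteSpace H] in
theorem primitive_zero (u₀ : H) (g : ℝ → H) : primitive u₀ g 0 = u₀ := by
  simp [primitive]

omit [CompleteSpace H] in
theorem continuousOn_primitive {u₀ : H} {g : ℝ → H} {S : ℝ} (hS : 0 ≤ S)
    (hg : MemLp g 2 (volume.restrict (Icc 0 S))) : ContinuousOn (primitive u₀ g) (Icc 0 S) := by
  have h := hg.intervalIntegrable_of_mem_Icc (t := S) ⟨hS, le_rfl⟩
  have := intervalIntegral.continuousOn_primitive_interval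
    ((intervalIntegrable_iff_integrableOn_Icc_of_le hS).1 h |>.mono_set (by rw [uIcc_of_le hS]))
  rw [uIcc_of_le hS] at this
  exact continuousOn_const.add this

theorem ContinuousOn.memLp_two_Icc {E : Type*} [NormedAddCommGroup E] {u : ℝ → E} {S : ℝ}
    (hu : ContinuousOn u (Icc 0 S)) : MemLp u 2 (volume.restrict (Icc 0 S)) := by
  obtain ⟨C, hC⟩ := isCompact_Icc.exists_bound_of_continuousOn hu
  refine MemLp.of_bound (hu.aestronglyMeasurable measurableSet_Icc) C ?_
  exact (ae_restrict_iff' measurableSet_Icc).2 (ae_of_all _ hC)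

theorem ContinuousLinearMap.primitive_comp {E : Type*} [NormedAddCommGroup E]
    [InnerProductSpace ℝ E] [CompleteSpace E] (L : H →L[ℝ] E) {u₀ : H} {g : ℝ → H} {S t : ℝ}
    (hg : MemLp g 2 (volume.restrict (Icc 0 S))) (ht : t ∈ Icc 0 S) :
    L (primitive u₀ g t) = L u₀ + ∫ s in (0 : ℝ)..t, L (g s) := by
  rw [L.intervalIntegral_comp_comm (hg.intervalIntegrable_of_mem_Icc ht), primitive, map_add]

variable (i : W →L[ℝ] H) (G : W →L[ℝ] K) (κ : ℝ) {S : ℝ} (u₀ : H) {g : ℝ → H}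

theorem memLp_regularSource (hS : 0 ≤ S) (hg : MemLp g 2 (volume.restrict (Icc 0 S))) :
    MemLp (regularSource i κ u₀ g) 2 (volume.restrict (Icc 0 S)) := by
  have hu := (continuousOn_primitive (u₀ := u₀) hS hg).memLp_two_Icc
  have h1 := hg.continuousLinearMap_comp (formResolvent i)
  have h2 := (hu.sub (hu.continuousLinearMap_comp (formResolvent i))).const_smul κ
  exact h1.add h2

variable {G i}
  (hG : ∀ a b : W, (inner ℝ (i a) (i b) : ℝ) + inner ℝ (G a) (G b) = inner ℝ a b)

include hG in
-- This is `A R = 1 - R` in weak form: `(i† u, w) = (u, i w)`, and the part `(i i† u, i w)` is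
-- subtracted from it.
theorem inner_form_adjoint (u : H) (w : W) :
    inner ℝ (G (ContinuousLinearMap.adjoint i u)) (G w)
      = inner ℝ (u - formResolvent i u) (i w) := by
  have h := hG (ContinuousLinearMap.adjoint i u) w
  rw [ContinuousLinearMap.adjoint_inner_left] at h
  simp only [formResolvent, ContinuousLinearMap.comp_apply, inner_sub_left]
  linarith

include hG in
-- `R u` has time derivative `R g` and satisfies `A R u = u - R u`, whence the form of
-- `regularSource`. No sign of `κ` enters.
theorem isFormSolution_formResolvent (hS : 0 ≤ S) (hg : MemLp g 2 (volume.restrict (Icc 0 S))) :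
    IsFormSolution i G κ S (regularSource i κ u₀ g) (fun t => formResolvent i (primitive u₀ g t))
      (fun t => ContinuousLinearMap.adjoint i (primitive u₀ g t)) := by
  have hu := continuousOn_primitive (u₀ := u₀) hS hg
  refine ⟨(formResolvent i).continuous.comp_continuousOn hu,
    hu.memLp_two_Icc.continuousLinearMap_comp _, ae_of_all _ fun t => rfl, fun w t ht => ?_⟩
  have hRg := (hg.continuousLinearMap_comp (formResolvent i)).intervalIntegrable_of_mem_Icc ht
  have hv : IntervalIntegrable
      (fun s => primitive u₀ g s - formResolvent i (primitive u₀ g s)) volume 0 t :=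
    (hu.memLp_two_Icc.sub (hu.memLp_two_Icc.continuousLinearMap_comp
      (formResolvent i))).intervalIntegrable_of_mem_Icc ht
  have hκv : IntervalIntegrable
      (fun s => κ • (primitive u₀ g s - formResolvent i (primitive u₀ g s))) volume 0 t :=
    hv.smul κ
  simp only [inner_form_adjoint hG]
  rw [primitive_zero, (formResolvent i).primitive_comp hg ht, inner_add_left]
  rw [intervalIntegral_inner_right ht.1 ((memLp_regularSource i κ u₀ hS hg).intervalIntegrable_of_mem_Icc ht)]
  rw [intervalIntegral_inner_right (a := fun s => primitive u₀ g s - formResolvent i (primitive u₀ g s)) ht.1 hv]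
  unfold regularSource
  rw [intervalIntegral.integral_add hRg hκv, intervalIntegral.integral_smul,
    inner_add_left, real_inner_smul_left]
  ring

include hG in
/-- The energy identity for regular solutions. -/
theorem energy_formResolvent (hS : 0 ≤ S) (hg : MemLp g 2 (volume.restrict (Icc 0 S)))
    {t : ℝ} (ht : t ∈ Icc 0 S) :
    ‖formResolvent i (primitive u₀ g t)‖ ^ 2
      + 2 * κ * (∫ s in (0 : ℝ)..t, ‖G (ContinuousLinearMap.adjoint i (primitive u₀ g s))‖ ^ 2)
      = ‖formResolvent i u₀‖ ^ 2
        + 2 * ∫ s in (0 : ℝ)..t,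
          inner ℝ (regularSource i κ u₀ g s) (formResolvent i (primitive u₀ g s)) := by
  have hu := continuousOn_primitive (u₀ := u₀) hS hg
  have hRg := (hg.continuousLinearMap_comp (formResolvent i)).intervalIntegrable_of_mem_Icc ht
  have hprim : ∀ s ∈ Icc 0 t, formResolvent i (primitive u₀ g s)
      = formResolvent i (primitive u₀ g 0) + ∫ r in (0 : ℝ)..s, formResolvent i (g r) := by
    intro s hs
    rw [primitive_zero, (formResolvent i).primitive_comp hg (Icc_subset_Icc_right ht.2 hs)]
  obtain ⟨⟨i1, i2⟩, h⟩ := integral_inner_add_integral_inner ht.1 hRg hRg hprim hprim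
  have hY := (hu.memLp_two_Icc.continuousLinearMap_comp
    (ContinuousLinearMap.adjoint i)).continuousLinearMap_comp G
  have hYsq : IntervalIntegrable
      (fun s => ‖G (ContinuousLinearMap.adjoint i (primitive u₀ g s))‖ ^ 2) volume 0 t := by
    rw [intervalIntegrable_iff_integrableOn_Icc_of_le ht.1]
    have : IntegrableOn (fun s => ‖G (ContinuousLinearMap.adjoint i (primitive u₀ g s))‖ ^ 2)
      (Icc 0 S) := hY.norm.integrable_sq
    exact this.mono_set (Icc_subset_Icc_right ht.2)
  have e : ∀ s, (inner ℝ (regularSource i κ u₀ g s) (formResolvent i (primitive u₀ g s)) : ℝ)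
      = inner ℝ (formResolvent i (g s)) (formResolvent i (primitive u₀ g s))
        + κ * ‖G (ContinuousLinearMap.adjoint i (primitive u₀ g s))‖ ^ 2 := by
    intro s
    rw [← real_inner_self_eq_norm_sq, inner_form_adjoint hG, regularSource, inner_add_left,
      real_inner_smul_left]
    rfl
  simp only [e]
  rw [intervalIntegral.integral_add i1 (hYsq.const_mul κ), intervalIntegral.integral_const_mul]
  simp only [real_inner_comm, real_inner_self_eq_norm_sq, primitive_zero] at h i1 ⊢
  linarith

include hG in
/-- The duality between regular solutions and solutions of the adjoint equation. -/
theorem duality_formResolvent [CompleteSpace K] (hS : 0 ≤ S) (hg : MemLp g 2 (volume.restrict (Icc 0 S)))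
    {p : ℝ → H} {P : ℝ → W} (hp : IsFormSolution i G (-κ) S (fun _ => 0) p P)
    {t : ℝ} (ht : t ∈ Icc 0 S) :
    inner ℝ (p t) (formResolvent i (primitive u₀ g t)) - inner ℝ (p 0) (formResolvent i u₀)
      = ∫ s in (0 : ℝ)..t, (inner ℝ (p s) (regularSource i κ u₀ g s) : ℝ) := by
  have hu := continuousOn_primitive (u₀ := u₀) hS hg
  -- Read in `W`, the equation of `p` says that `i† p` is a primitive of `D P`. Since `(p, R u) =
  -- (i† p, i† u)`, the product rule applies in `W`, and `p` needs no time derivative in `H`.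
  set D : W →L[ℝ] W := κ • (ContinuousLinearMap.adjoint G ∘L G) with hD
  have hDP := (hp.memLp.continuousLinearMap_comp D).intervalIntegrable_of_mem_Icc ht
  have hig := (hg.continuousLinearMap_comp
    (ContinuousLinearMap.adjoint i)).intervalIntegrable_of_mem_Icc ht
  have hDin : ∀ a b, (inner ℝ (D a) b : ℝ) = κ * inner ℝ (G a) (G b) := by
    intro a b
    simp [hD, real_inner_smul_left, ContinuousLinearMap.adjoint_inner_left]
  have h1 : ∀ s ∈ Icc 0 t, ContinuousLinearMap.adjoint i (p s)
      = ContinuousLinearMap.adjoint i (p 0) + ∫ r in (0 : ℝ)..s, D (P r) := by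
    intro s hs
    have hs' := Icc_subset_Icc_right ht.2 hs
    refine ext_inner_right ℝ fun w => ?_
    have := hp.weak_eq w s hs'
    rw [inner_add_left, ContinuousLinearMap.adjoint_inner_left,
      ContinuousLinearMap.adjoint_inner_left, ← intervalIntegral_inner_right hs.1
      ((hp.memLp.continuousLinearMap_comp D).intervalIntegrable_of_mem_Icc hs')]
    simp only [hDin, intervalIntegral.integral_const_mul]
    simp only [inner_zero_left, intervalIntegral.integral_zero] at this
    linarith
  have h2 : ∀ s ∈ Icc 0 t, ContinuousLinearMap.adjoint i (primitive u₀ g s)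
      = ContinuousLinearMap.adjoint i (primitive u₀ g 0)
        + ∫ r in (0 : ℝ)..s, ContinuousLinearMap.adjoint i (g r) := by
    intro s hs
    rw [primitive_zero,
      (ContinuousLinearMap.adjoint i).primitive_comp hg (Icc_subset_Icc_right ht.2 hs)]
  obtain ⟨⟨i1, i2⟩, h⟩ := integral_inner_add_integral_inner ht.1 hDP hig h1 h2
  rw [← intervalIntegral.integral_add i1 i2, primitive_zero] at h
  have hin : ∀ a b : H, (inner ℝ (ContinuousLinearMap.adjoint i a) (ContinuousLinearMap.adjoint i b) : ℝ)
      = inner ℝ a (formResolvent i b) := fun a b => ContinuousLinearMap.adjoint_inner_left _ _ _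
  rw [hin, hin] at h
  rw [← h]
  -- Pointwise, `κ (G P, G i† u) = κ (p, u - R u)` and `(i† p, i† g) = (p, R g)`; their sum is the
  -- pairing of `p` with the regular source.
  refine intervalIntegral.integral_congr_ae_restrict ?_
  rw [uIoc_of_le ht.1]
  filter_upwards [ae_restrict_of_ae_restrict_of_subset
    (Ioc_subset_Icc_self.trans (Icc_subset_Icc_right ht.2)) hp.ae_eq] with s hs
  rw [hin, hDin, real_inner_comm, inner_form_adjoint hG, hs, regularSource, inner_add_right,
    real_inner_smul_right, real_inner_comm (p s)]
  ring

end RegularSolutions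

/-! ### The a priori estimate for regular solutions. -/

section RegularSpace

variable {H W K : Type*} [NormedAddCommGroup H] [InnerProductSpace ℝ H]
  [NormedAddCommGroup W] [InnerProductSpace ℝ W]
  [NormedAddCommGroup K] [InnerProductSpace ℝ K]

/-- The space `L²([0, S]; E)`. -/
abbrev TimeL2 (E : Type*) [NormedAddCommGroup E] (S : ℝ) : Type _ :=
  Lp E 2 (volume.restrict (Icc (0 : ℝ) S))

/-- Quadruples of a trajectory in `C([0, S]; H)`, a trajectory in `L²([0, S]; W)`, an initial value
and a source. -/
abbrev SolutionSpace (H W : Type*) [NormedAddCommGroup H] [NormedAddCommGroup W] (S : ℝ) : Type _ :=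
  (C(Icc (0 : ℝ) S, H) × TimeL2 W S) × (H × TimeL2 H S)

theorem TimeL2.norm_sq_eq_integral {S : ℝ} (f : TimeL2 H S) :
    ‖f‖ ^ 2 = ∫ s in Icc 0 S, ‖f s‖ ^ 2 := by
  rw [← real_inner_self_eq_norm_sq, L2.inner_def]
  simp only [real_inner_self_eq_norm_sq]

theorem MeasureTheory.MemLp.integrable_inner_two {α : Type*} {m : MeasurableSpace α}
    {μ : Measure α} {f g : α → H} (hf : MemLp f 2 μ) (hg : MemLp g 2 μ) :
    Integrable (fun x => (inner ℝ (f x) (g x) : ℝ)) μ :=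
  (L2.integrable_inner (𝕜 := ℝ) (hf.toLp f) (hg.toLp g)).congr
    (by filter_upwards [hf.coeFn_toLp, hg.coeFn_toLp] with x h1 h2 using by rw [h1, h2])

theorem primitive_add {u₀ u₁ : H} {g g' : ℝ → H} {S t : ℝ}
    (hg : MemLp g 2 (volume.restrict (Icc 0 S))) (hg' : MemLp g' 2 (volume.restrict (Icc 0 S)))
    (ht : t ∈ Icc 0 S) :
    primitive (u₀ + u₁) (g + g') t = primitive u₀ g t + primitive u₁ g' t := by
  simp only [primitive, Pi.add_apply]
  rw [intervalIntegral.integral_add (hg.intervalIntegrable_of_mem_Icc ht)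
    (hg'.intervalIntegrable_of_mem_Icc ht)]
  abel

theorem primitive_smul (c : ℝ) (u₀ : H) (g : ℝ → H) (t : ℝ) :
    primitive (c • u₀) (c • g) t = c • primitive u₀ g t := by
  simp only [primitive, Pi.smul_apply, intervalIntegral.integral_smul, smul_add]

variable [CompleteSpace H] [CompleteSpace W]

/-- The solutions `(1 + A)⁻¹ u` of the evolution equation, for the primitives `u` of
square-integrable functions, with their initial values and sources. -/
noncomputable def regularSolutions (i : W →L[ℝ] H) (κ S : ℝ) : Submodule ℝ (SolutionSpace H W S) where
  carrier := {e | ∃ (u₀ : H) (g : ℝ → H), MemLp g 2 (volume.restrict (Icc 0 S)) ∧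
    (∀ t : Icc (0 : ℝ) S, e.1.1 t = formResolvent i (primitive u₀ g t)) ∧
    (e.1.2 =ᵐ[volume.restrict (Icc 0 S)]
      fun t => ContinuousLinearMap.adjoint i (primitive u₀ g t)) ∧
    e.2.1 = formResolvent i u₀ ∧
    e.2.2 =ᵐ[volume.restrict (Icc 0 S)] regularSource i κ u₀ g}
  zero_mem' := by
    have h0 : ∀ t, primitive (0 : H) 0 t = 0 := fun t => by simp [primitive]
    refine ⟨0, 0, MemLp.zero', fun t => by simp [h0], ?_, by simp, ?_⟩
    · filter_upwards [Lp.coeFn_zero W 2 (volume.restrict (Icc (0 : ℝ) S))] with t ht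
      simpa [h0] using ht
    · filter_upwards [Lp.coeFn_zero H 2 (volume.restrict (Icc (0 : ℝ) S))] with t ht
      simpa [regularSource, h0] using ht
  add_mem' := by
    rintro e e' ⟨u₀, g, hg, h1, h2, h3, h4⟩ ⟨u₁, g', hg', h1', h2', h3', h4'⟩
    refine ⟨u₀ + u₁, g + g', hg.add hg', fun t => ?_, ?_, ?_, ?_⟩
    · rw [primitive_add hg hg' t.2, map_add, ← h1, ← h1']
      rfl
    · filter_upwards [Lp.coeFn_add e.1.2 e'.1.2, h2, h2', ae_restrict_mem measurableSet_Icc]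
        with t ha hb hb' ht
      rw [primitive_add hg hg' ht, map_add, ← hb, ← hb']
      exact ha
    · rw [map_add, ← h3, ← h3']
      rfl
    · filter_upwards [Lp.coeFn_add e.2.2 e'.2.2, h4, h4', ae_restrict_mem measurableSet_Icc]
        with t ha hb hb' ht
      rw [regularSource, primitive_add hg hg' ht, Pi.add_apply, map_add, map_add]
      refine ha.trans ?_
      rw [Pi.add_apply, hb, hb', regularSource, regularSource]
      module
  smul_mem' := by
    rintro c e ⟨u₀, g, hg, h1, h2, h3, h4⟩
    refine ⟨c • u₀, c • g, hg.const_smul c, fun t => ?_, ?_, ?_, ?_⟩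
    · rw [primitive_smul, map_smul, ← h1]
      rfl
    · filter_upwards [Lp.coeFn_smul c e.1.2, h2] with t ha hb
      rw [primitive_smul, map_smul, ← hb]
      exact ha
    · rw [map_smul, ← h3]
      rfl
    · filter_upwards [Lp.coeFn_smul c e.2.2, h4] with t ha hb
      rw [regularSource, primitive_smul, Pi.smul_apply, map_smul, map_smul]
      refine ha.trans ?_
      rw [Pi.smul_apply, hb, regularSource]
      module

variable {i : W →L[ℝ] H} {G : W →L[ℝ] K}
  (hG : ∀ a b : W, (inner ℝ (i a) (i b) : ℝ) + inner ℝ (G a) (G b) = inner ℝ a b)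

include hG in
-- Both bounds follow from the energy identity: the source term is split by Young's inequality and
-- half of the squared supremum norm `M ^ 2` is absorbed. In the second bound, `2 * S` comes from
-- integrating `‖y‖² ≤ 2 Q`, and `1 / κ` from the dissipation.
theorem norm_le_of_mem_regularSolutions {κ S : ℝ} (hκ : 0 < κ) (hS : 0 < S)
    {e : SolutionSpace H W S} (he : e ∈ regularSolutions i κ S) :
    ‖e.1.1‖ ^ 2 ≤ 2 * (‖e.2.1‖ ^ 2 + 2 * S * ‖e.2.2‖ ^ 2) ∧
      ‖e.1.2‖ ^ 2 ≤ (2 * S + 1 / κ) * (‖e.2.1‖ ^ 2 + 2 * S * ‖e.2.2‖ ^ 2) := by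
  obtain ⟨u₀, g, hg, h1, h2, h3, h4⟩ := he
  set Q := ‖e.2.1‖ ^ 2 + 2 * S * ‖e.2.2‖ ^ 2 with hQ
  set M := ‖e.1.1‖ with hM
  have hu := continuousOn_primitive (u₀ := u₀) hS.le hg
  have hQ0 : 0 ≤ Q := by positivity
  have hyM : ∀ t ∈ Icc 0 S, ‖formResolvent i (primitive u₀ g t)‖ ≤ M := fun t ht => by
    rw [← h1 ⟨t, ht⟩]
    exact e.1.1.norm_coe_le_norm _
  have hf2 : ∫ s in Icc 0 S, ‖regularSource i κ u₀ g s‖ ^ 2 = ‖e.2.2‖ ^ 2 := by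
    rw [TimeL2.norm_sq_eq_integral]
    exact integral_congr_ae (h4.mono fun t ht => by simp only [ht])
  have hfi : IntegrableOn (fun s => ‖regularSource i κ u₀ g s‖ ^ 2) (Icc 0 S) :=
    (memLp_regularSource i κ u₀ hS.le hg).norm.integrable_sq
  have hYi : IntegrableOn
      (fun s => ‖G (ContinuousLinearMap.adjoint i (primitive u₀ g s))‖ ^ 2) (Icc 0 S) :=
    ((hu.memLp_two_Icc.continuousLinearMap_comp
      (ContinuousLinearMap.adjoint i)).continuousLinearMap_comp G).norm.integrable_sq
  have hyi : IntegrableOn (fun s => ‖formResolvent i (primitive u₀ g s)‖ ^ 2) (Icc 0 S) :=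
    (hu.memLp_two_Icc.continuousLinearMap_comp (formResolvent i)).norm.integrable_sq
  have hsrc : ∀ t ∈ Icc 0 S, 2 * ∫ s in (0 : ℝ)..t,
      (inner ℝ (regularSource i κ u₀ g s) (formResolvent i (primitive u₀ g s)) : ℝ)
        ≤ 2 * S * ‖e.2.2‖ ^ 2 + M ^ 2 / 2 := by
    intro t ht
    have hb : IntegrableOn (fun s => S * ‖regularSource i κ u₀ g s‖ ^ 2 + M ^ 2 / (4 * S))
        (Icc 0 S) := (hfi.const_mul S).add (integrable_const _)
    have hle : ∫ s in (0 : ℝ)..t,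
        (inner ℝ (regularSource i κ u₀ g s) (formResolvent i (primitive u₀ g s)) : ℝ)
        ≤ ∫ s in Icc 0 S, (S * ‖regularSource i κ u₀ g s‖ ^ 2 + M ^ 2 / (4 * S)) := by
      rw [intervalIntegral.integral_of_le ht.1]
      have hsub : Ioc 0 t ⊆ Icc 0 S := Ioc_subset_Icc_self.trans (Icc_subset_Icc_right ht.2)
      refine le_trans (setIntegral_mono_on (IntegrableOn.mono_set
        (MemLp.integrable_inner_two (memLp_regularSource i κ u₀ hS.le hg)
          (hu.memLp_two_Icc.continuousLinearMap_comp (formResolvent i))) hsub)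
        (hb.mono_set hsub) measurableSet_Ioc fun s hs => ?_)
        (setIntegral_mono_set hb (ae_of_all _ fun s => ?_) hsub.eventuallyLE)
      · refine (real_inner_le_norm _ _).trans ?_
        have h5 := mul_le_mul_of_nonneg_left (hyM s (hsub hs))
          (norm_nonneg (regularSource i κ u₀ g s))
        have h6 : ‖regularSource i κ u₀ g s‖ * M
            ≤ S * ‖regularSource i κ u₀ g s‖ ^ 2 + M ^ 2 / (4 * S) := by
          -- The weight `S` makes the constant term integrate to `M ^ 2 / 4` over `[0, S]`, so that
          -- `M ^ 2 / 2` remains after doubling.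
          have : S * ‖regularSource i κ u₀ g s‖ ^ 2 + M ^ 2 / (4 * S)
              - ‖regularSource i κ u₀ g s‖ * M
              = S * (‖regularSource i κ u₀ g s‖ - M / (2 * S)) ^ 2 := by
            field_simp
            ring
          nlinarith [mul_nonneg hS.le (sq_nonneg (‖regularSource i κ u₀ g s‖ - M / (2 * S)))]
        exact h5.trans h6
      · simp only [Pi.zero_apply]
        positivity
    rw [integral_add (hfi.const_mul S) (integrable_const _), integral_const_mul, hf2] at hle
    have hc : ∫ _ in Icc 0 S, M ^ 2 / (4 * S) = M ^ 2 / 4 := by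
      simp [hS.le]
      field_simp
    linarith
  have hen : ∀ t ∈ Icc 0 S, ‖formResolvent i (primitive u₀ g t)‖ ^ 2
      + 2 * κ * (∫ s in (0 : ℝ)..t, ‖G (ContinuousLinearMap.adjoint i (primitive u₀ g s))‖ ^ 2)
      ≤ Q + M ^ 2 / 2 := by
    intro t ht
    rw [energy_formResolvent κ u₀ hG hS.le hg ht, hQ, h3]
    linarith [hsrc t ht]
  have hM2 : M ^ 2 ≤ 2 * Q := by
    have hle : M ≤ Real.sqrt (Q + M ^ 2 / 2) := by
      refine (ContinuousMap.norm_le _ (Real.sqrt_nonneg _)).2 fun t => ?_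
      refine Real.le_sqrt_of_sq_le ?_
      rw [h1]
      refine le_trans (le_add_of_nonneg_right ?_) (hen t t.2)
      have := intervalIntegral.integral_nonneg (μ := volume) t.2.1
        (fun s _ => sq_nonneg ‖G (ContinuousLinearMap.adjoint i (primitive u₀ g s))‖)
      positivity
    have := Real.sq_sqrt (show 0 ≤ Q + M ^ 2 / 2 by positivity)
    have h5 : M ^ 2 ≤ Real.sqrt (Q + M ^ 2 / 2) ^ 2 := by
      have : 0 ≤ M := norm_nonneg _
      gcongr
    linarith
  refine ⟨hM2, ?_⟩
  have hY : ‖e.1.2‖ ^ 2 = (∫ s in Icc 0 S, ‖formResolvent i (primitive u₀ g s)‖ ^ 2)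
      + ∫ s in Icc 0 S, ‖G (ContinuousLinearMap.adjoint i (primitive u₀ g s))‖ ^ 2 := by
    rw [TimeL2.norm_sq_eq_integral, ← integral_add hyi hYi]
    refine integral_congr_ae (h2.mono fun t ht => ?_)
    have := hG (ContinuousLinearMap.adjoint i (primitive u₀ g t))
      (ContinuousLinearMap.adjoint i (primitive u₀ g t))
    simp only [real_inner_self_eq_norm_sq] at this
    simp only [ht, ← this]
    rfl
  have hy : ∫ s in Icc 0 S, ‖formResolvent i (primitive u₀ g s)‖ ^ 2 ≤ 2 * S * Q := by
    calc _ ≤ ∫ s in Icc 0 S, 2 * Q := by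
          refine setIntegral_mono_on hyi (integrable_const _) measurableSet_Icc fun s hs => ?_
          exact (pow_le_pow_left₀ (norm_nonneg _) (hyM s hs) 2).trans hM2
      _ = 2 * S * Q := by simp [hS.le]; ring
  have hg2 : ∫ s in Icc 0 S, ‖G (ContinuousLinearMap.adjoint i (primitive u₀ g s))‖ ^ 2
      ≤ 1 / κ * Q := by
    have := hen S ⟨hS.le, le_rfl⟩
    rw [intervalIntegral.integral_of_le hS.le, ← integral_Icc_eq_integral_Ioc] at this
    rw [one_div, inv_mul_eq_div, le_div_iff₀ hκ]
    nlinarith [sq_nonneg ‖formResolvent i (primitive u₀ g S)‖]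
  rw [hY]
  linarith

include hG in
-- The data `(y₀, f)` control the whole quadruple; this is the form of the estimate that extends to
-- the closure.
theorem exists_norm_le_of_mem_regularSolutions {κ S : ℝ} (hκ : 0 < κ) (hS : 0 < S) :
    ∃ C : NNReal, ∀ e ∈ regularSolutions i κ S, ‖e‖ ≤ C * ‖e.2‖ := by
  -- The summand `2` covers the supremum bound; it also yields `1 ≤ c`, needed for the data
  -- component itself.
  set c := (2 * S + 1 / κ + 2) * (1 + 2 * S) with hc
  have hk : 0 < 1 / κ := by positivity
  have hc1 : 1 ≤ c := by nlinarith [mul_pos hk hS, mul_pos hS hS]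
  refine ⟨⟨Real.sqrt c, Real.sqrt_nonneg _⟩, fun e he => ?_⟩
  obtain ⟨h1, h2⟩ := norm_le_of_mem_regularSolutions hG hκ hS he
  have hQ : ‖e.2.1‖ ^ 2 + 2 * S * ‖e.2.2‖ ^ 2 ≤ (1 + 2 * S) * ‖e.2‖ ^ 2 := by
    have a1 : ‖e.2.1‖ ^ 2 ≤ ‖e.2‖ ^ 2 := pow_le_pow_left₀ (norm_nonneg _) (norm_fst_le _) 2
    have a2 : ‖e.2.2‖ ^ 2 ≤ ‖e.2‖ ^ 2 := pow_le_pow_left₀ (norm_nonneg _) (norm_snd_le _) 2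
    nlinarith
  have key : ∀ x : ℝ, x ^ 2 ≤ c * ‖e.2‖ ^ 2 → x ≤ Real.sqrt c * ‖e.2‖ := fun x hx => by
    rw [← Real.sqrt_sq (norm_nonneg e.2), ← Real.sqrt_mul (by linarith)]
    exact Real.le_sqrt_of_sq_le hx
  have hQ0 : 0 ≤ (1 + 2 * S) * ‖e.2‖ ^ 2 := by positivity
  rw [Prod.norm_def, Prod.norm_def (x := e.1)]
  refine max_le (max_le (key _ ?_) (key _ ?_)) (key _ ?_)
  · rw [hc]; nlinarith
  · rw [hc]
    have : (2 * S + 1 / κ) * (‖e.2.1‖ ^ 2 + 2 * S * ‖e.2.2‖ ^ 2)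
        ≤ (2 * S + 1 / κ) * ((1 + 2 * S) * ‖e.2‖ ^ 2) := by gcongr
    nlinarith
  · nlinarith [sq_nonneg ‖e.2‖]

end RegularSpace

/-! ### Existence of weak solutions by closure and density. -/

section Existence

variable {H W K : Type*} [NormedAddCommGroup H] [InnerProductSpace ℝ H]
  [NormedAddCommGroup W] [InnerProductSpace ℝ W]
  [NormedAddCommGroup K] [InnerProductSpace ℝ K]

/-- The integral is the `L²` inner product with `q` cut off at `t`. This continuity carries integral
identities over to the closure. -/
theorem continuous_intervalIntegral_inner {S t : ℝ} {q : ℝ → H}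
    (hq : MemLp q 2 (volume.restrict (Icc 0 S))) (ht : t ∈ Icc 0 S) :
    Continuous fun f : TimeL2 H S => ∫ s in (0 : ℝ)..t, (inner ℝ (q s) (f s) : ℝ) := by
  have hq' := hq.indicator (measurableSet_Ioc (a := (0 : ℝ)) (b := t))
  have hsub : Ioc 0 t ⊆ Icc 0 S := Ioc_subset_Icc_self.trans (Icc_subset_Icc_right ht.2)
  have : ∀ f : TimeL2 H S, ∫ s in (0 : ℝ)..t, (inner ℝ (q s) (f s) : ℝ)
      = inner ℝ (hq'.toLp _) f := by
    intro f
    have hind : ∫ s in Icc 0 S, (Ioc 0 t).indicator (fun s => (inner ℝ (q s) (f s) : ℝ)) s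
        = ∫ s in Ioc 0 t, inner ℝ (q s) (f s) := by
      rw [setIntegral_indicator measurableSet_Ioc, inter_eq_self_of_subset_right hsub]
    rw [L2.inner_def, intervalIntegral.integral_of_le ht.1, ← hind]
    refine integral_congr_ae ?_
    filter_upwards [hq'.coeFn_toLp] with s hs
    rw [hs]
    by_cases h : s ∈ Ioc 0 t <;> simp [h]
  simp only [this]
  exact continuous_const.inner continuous_id

theorem intervalIntegral_inner_congr {S t : ℝ} (ht : t ∈ Icc 0 S) {f g : ℝ → H}
    (h : f =ᵐ[volume.restrict (Icc 0 S)] g) (q : ℝ → H) :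
    ∫ s in (0 : ℝ)..t, (inner ℝ (q s) (f s) : ℝ) = ∫ s in (0 : ℝ)..t, inner ℝ (q s) (g s) := by
  refine intervalIntegral.integral_congr_ae_restrict ?_
  rw [uIoc_of_le ht.1]
  filter_upwards [ae_restrict_of_ae_restrict_of_subset
    (Ioc_subset_Icc_self.trans (Icc_subset_Icc_right ht.2)) h] with s hs
  rw [hs]

omit [InnerProductSpace ℝ H] in
theorem memLp_IccExtend {S : ℝ} (hS : 0 ≤ S) (y : C(Icc (0 : ℝ) S, H)) :
    MemLp (IccExtend hS y) 2 (volume.restrict (Icc 0 S)) :=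
  (y.continuous.Icc_extend' (h := hS)).continuousOn.memLp_two_Icc

/-- Continuous functions on `[0, S]` as square-integrable functions. -/
noncomputable def continuousToTimeL2 {S : ℝ} (hS : 0 ≤ S) :
    C(Icc (0 : ℝ) S, H) →L[ℝ] TimeL2 H S :=
  LinearMap.mkContinuous
    { toFun := fun y => (memLp_IccExtend hS y).toLp _
      map_add' := fun y z => MemLp.toLp_add (memLp_IccExtend hS y) (memLp_IccExtend hS z)
      map_smul' := fun c y => MemLp.toLp_const_smul c (memLp_IccExtend hS y) }
    ((volume.restrict (Icc (0 : ℝ) S)).real univ ^ (ENNReal.toReal 2)⁻¹) (fun y => by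
      refine Lp.norm_le_of_ae_bound (norm_nonneg _) ?_
      filter_upwards [(memLp_IccExtend hS y).coeFn_toLp] with t ht
      exact (congrArg norm ht).trans_le (y.norm_coe_le_norm _))

theorem coeFn_continuousToTimeL2 {S : ℝ} (hS : 0 ≤ S) (y : C(Icc (0 : ℝ) S, H)) :
    continuousToTimeL2 hS y =ᵐ[volume.restrict (Icc 0 S)] IccExtend hS y :=
  (memLp_IccExtend hS y).coeFn_toLp

variable [CompleteSpace H] [CompleteSpace W]
variable {i : W →L[ℝ] H} {G : W →L[ℝ] K}
  (hG : ∀ a b : W, (inner ℝ (i a) (i b) : ℝ) + inner ℝ (G a) (G b) = inner ℝ a b)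

theorem exists_mem_regularSolutions (i : W →L[ℝ] H) (κ : ℝ) {S : ℝ} (hS : 0 ≤ S) (u₀ : H)
    {g : ℝ → H} (hg : MemLp g 2 (volume.restrict (Icc 0 S))) :
    ∃ e ∈ regularSolutions i κ S, e.2 = (formResolvent i u₀,
      (memLp_regularSource i κ u₀ hS hg).toLp _) := by
  have hu := continuousOn_primitive (u₀ := u₀) hS hg
  have hY := hu.memLp_two_Icc.continuousLinearMap_comp (ContinuousLinearMap.adjoint i)
  have hf := memLp_regularSource i κ u₀ hS hg
  exact ⟨((⟨fun t => formResolvent i (primitive u₀ g t),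
    (formResolvent i).continuous.comp (continuousOn_iff_continuous_domRestrict.1 hu)⟩,
    hY.toLp _), (formResolvent i u₀, hf.toLp _)),
    ⟨u₀, g, hg, fun t => rfl, hY.coeFn_toLp, rfl, hf.coeFn_toLp⟩, rfl⟩

include hG in
-- The a priori estimate survives in the closure and, by linearity, makes the projection to the data
-- antilipschitz on a complete space.
theorem isClosed_snd_image_closure {κ S : ℝ} (hκ : 0 < κ) (hS : 0 < S) :
    IsClosed (Prod.snd '' ((regularSolutions i κ S).topologicalClosure : Set (SolutionSpace H W S))) := by
  obtain ⟨C, hC⟩ := exists_norm_le_of_mem_regularSolutions hG hκ hS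
  have hC' : ∀ e ∈ (regularSolutions i κ S).topologicalClosure, ‖e‖ ≤ C * ‖e.2‖ := by
    have hcl : IsClosed {e : SolutionSpace H W S | ‖e‖ ≤ C * ‖e.2‖} :=
      isClosed_le continuous_norm (continuous_const.mul continuous_snd.norm)
    exact fun e he => closure_minimal hC hcl he
  set N := (regularSolutions i κ S).topologicalClosure
  have hcomp : CompleteSpace N :=
    (Submodule.isClosed_topologicalClosure _).completeSpace_coe
  have hrange : Prod.snd '' (N : Set (SolutionSpace H W S)) = range (fun e : N => e.1.2) := by
    ext d
    simp
  rw [hrange]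
  refine AntilipschitzWith.isClosed_range (K := C) ?_
    ((uniformContinuous_snd).comp uniformContinuous_subtype_val)
  refine AntilipschitzWith.of_le_mul_dist fun a b => ?_
  have := hC' _ (a - b).2
  rw [dist_eq_norm, dist_eq_norm]
  exact this

include hG in
theorem norm_adjoint_le (x : H) : ‖ContinuousLinearMap.adjoint i x‖ ≤ ‖x‖ := by
  have h1 : ∀ w, ‖i w‖ ≤ ‖w‖ := by
    intro w
    have := hG w w
    simp only [real_inner_self_eq_norm_sq] at this
    exact le_of_sq_le_sq (by nlinarith [sq_nonneg ‖G w‖]) (norm_nonneg _)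
  calc _ ≤ ‖ContinuousLinearMap.adjoint i‖ * ‖x‖ := ContinuousLinearMap.le_opNorm _ _
    _ ≤ 1 * ‖x‖ := by
      gcongr
      rw [LinearIsometryEquiv.norm_map]
      exact ContinuousLinearMap.opNorm_le_bound _ zero_le_one (by simpa using h1)
    _ = ‖x‖ := one_mul _

include hG in
/-- A source that is orthogonal to the regular source it generates vanishes. -/
theorem eq_zero_of_inner_regularSource_eq_zero (hi : ∀ q : H, (∀ w, inner ℝ q (i w) = 0) → q = 0)
    {κ S : ℝ} (hκ : 0 < κ) (hS : 0 < S) (f : TimeL2 H S)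
    (h : ∫ s in Icc 0 S, (inner ℝ (regularSource i κ 0 f s) (f s) : ℝ) = 0) : f = 0 := by
  have hS' : S ∈ Icc 0 S := ⟨hS.le, le_rfl⟩
  have hf := Lp.memLp f
  have hif := hf.continuousLinearMap_comp (ContinuousLinearMap.adjoint i)
  have hf' := hf.intervalIntegrable_of_mem_Icc hS'
  have hif' := hif.intervalIntegrable_of_mem_Icc hS'
  have hp : ∀ s ∈ Icc 0 S, primitive 0 f s = primitive 0 f 0 + ∫ r in (0 : ℝ)..s, f r :=
    fun s _ => by rw [primitive_zero, primitive]
  have hip : ∀ s ∈ Icc 0 S, ContinuousLinearMap.adjoint i (primitive 0 f s)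
      = ContinuousLinearMap.adjoint i (primitive 0 f 0)
        + ∫ r in (0 : ℝ)..s, ContinuousLinearMap.adjoint i (f r) :=
    fun s hs => by rw [primitive_zero, (ContinuousLinearMap.adjoint i).primitive_comp hf hs]
  obtain ⟨⟨-, i1⟩, h1⟩ := integral_inner_add_integral_inner hS.le hf' hf' hp hp
  obtain ⟨⟨-, i2⟩, h2⟩ := integral_inner_add_integral_inner hS.le hif' hif' hip hip
  have hi3 : IntegrableOn (fun s => ‖ContinuousLinearMap.adjoint i (f s)‖ ^ 2) (Icc 0 S) :=
    hif.norm.integrable_sq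
  have i3 := (intervalIntegrable_iff_integrableOn_Icc_of_le hS.le).2 hi3
  have hRin : ∀ a b : H, (inner ℝ (formResolvent i a) b : ℝ)
      = inner ℝ (ContinuousLinearMap.adjoint i a) (ContinuousLinearMap.adjoint i b) :=
    fun a b => by rw [ContinuousLinearMap.adjoint_inner_right]; rfl
  -- With `u = ∫ f`, the bracket is the derivative of `½ (‖u‖² - ‖i† u‖²)`. It starts at `0` and
  -- ends nonnegative because `‖i†‖ ≤ 1`, so `∫ ‖i† f‖² ≤ 0`.
  have e : ∀ s, (inner ℝ (regularSource i κ 0 f s) (f s) : ℝ)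
      = ‖ContinuousLinearMap.adjoint i (f s)‖ ^ 2 + κ * (inner ℝ (primitive 0 f s) (f s)
        - inner ℝ (ContinuousLinearMap.adjoint i (primitive 0 f s))
          (ContinuousLinearMap.adjoint i (f s))) := by
    intro s
    rw [regularSource, inner_add_left, real_inner_smul_left, inner_sub_left, hRin, hRin,
      real_inner_self_eq_norm_sq]
  rw [integral_Icc_eq_integral_Ioc, ← intervalIntegral.integral_of_le hS.le] at h
  simp only [e] at h
  rw [intervalIntegral.integral_add i3 ((i1.sub i2).const_mul κ),
    intervalIntegral.integral_const_mul, intervalIntegral.integral_sub i1 i2] at h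
  have c1 : ∫ s in (0 : ℝ)..S, (inner ℝ (f s) (primitive 0 f s) : ℝ)
      = ∫ s in (0 : ℝ)..S, inner ℝ (primitive 0 f s) (f s) := by
    simp only [real_inner_comm]
  have c2 : ∫ s in (0 : ℝ)..S, (inner ℝ (ContinuousLinearMap.adjoint i (f s))
        (ContinuousLinearMap.adjoint i (primitive 0 f s)) : ℝ)
      = ∫ s in (0 : ℝ)..S, inner ℝ (ContinuousLinearMap.adjoint i (primitive 0 f s))
        (ContinuousLinearMap.adjoint i (f s)) := by
    simp only [real_inner_comm]
  rw [c1, primitive_zero, inner_zero_left, real_inner_self_eq_norm_sq] at h1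
  rw [c2, primitive_zero, map_zero, inner_zero_left, real_inner_self_eq_norm_sq] at h2
  have hle : ∫ s in Icc 0 S, ‖ContinuousLinearMap.adjoint i (f s)‖ ^ 2 ≤ 0 := by
    rw [integral_Icc_eq_integral_Ioc, ← intervalIntegral.integral_of_le hS.le]
    have := pow_le_pow_left₀ (norm_nonneg _) (norm_adjoint_le hG (primitive 0 f S)) 2
    nlinarith
  have hz := (integral_eq_zero_iff_of_nonneg (fun s => sq_nonneg _) hi3).1
    (le_antisymm hle (integral_nonneg fun s => sq_nonneg _))
  rw [Lp.eq_zero_iff_ae_eq_zero]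
  filter_upwards [hz] with s hs
  refine hi _ fun w => ?_
  have h0 : ContinuousLinearMap.adjoint i (f s) = 0 :=
    norm_eq_zero.1 (pow_eq_zero_iff two_ne_zero |>.1 hs)
  rw [← ContinuousLinearMap.adjoint_inner_left, h0, inner_zero_left]

include hG in
-- The reachable data form a closed subspace. A source `f` orthogonal to it is orthogonal to the
-- regular source generated by `g = f` with `u₀ = 0`, hence zero. With all sources available, every
-- `R q` is a reachable initial value, and `q ⊥ R q` means `‖i† q‖² = 0`, hence `q = 0`.
theorem exists_mem_closure_regularSolutions (hi : ∀ q : H, (∀ w, inner ℝ q (i w) = 0) → q = 0)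
    {κ S : ℝ} (hκ : 0 < κ) (hS : 0 < S) (y₀ : H) (f : TimeL2 H S) :
    ∃ e ∈ (regularSolutions i κ S).topologicalClosure, e.2 = (y₀, f) := by
  set N := (regularSolutions i κ S).topologicalClosure
  set Q : Submodule ℝ (H × TimeL2 H S) := N.map (LinearMap.snd ℝ _ _)
  have hQcl : IsClosed (Q : Set (H × TimeL2 H S)) := isClosed_snd_image_closure hG hκ hS
  have hreg : ∀ (u₀ : H) (g : ℝ → H) (hg : MemLp g 2 (volume.restrict (Icc 0 S))),
      (formResolvent i u₀, (memLp_regularSource i κ u₀ hS.le hg).toLp _) ∈ Q := by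
    intro u₀ g hg
    obtain ⟨e, he, h2⟩ := exists_mem_regularSolutions i κ hS.le u₀ hg
    exact ⟨e, Submodule.le_topologicalClosure _ he, h2⟩
  have hF : ∀ f : TimeL2 H S, ((0 : H), f) ∈ Q := by
    set F : Submodule ℝ (TimeL2 H S) := Q.comap (LinearMap.inr ℝ H (TimeL2 H S))
    have hFcl : IsClosed (F : Set (TimeL2 H S)) :=
      hQcl.preimage (continuous_const.prodMk continuous_id)
    have htop : F = ⊤ := by
      rw [← hFcl.submodule_topologicalClosure_eq, Submodule.topologicalClosure_eq_top_iff,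
        Submodule.eq_bot_iff]
      intro f hf
      have hmem := hreg 0 f (Lp.memLp f)
      rw [map_zero] at hmem
      have h0 : (inner ℝ ((memLp_regularSource i κ 0 hS.le (Lp.memLp f)).toLp _) f : ℝ) = 0 :=
        (Submodule.mem_orthogonal F f).1 hf _ hmem
      rw [L2.inner_def] at h0
      refine eq_zero_of_inner_regularSource_eq_zero hG hi hκ hS f (Eq.trans ?_ h0)
      refine integral_congr_ae ?_
      filter_upwards [MemLp.coeFn_toLp (memLp_regularSource i κ 0 hS.le (Lp.memLp f))] with s hs
      rw [hs]
    intro f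
    have : f ∈ F := htop ▸ Submodule.mem_top
    exact this
  have hI : ∀ y : H, (y, (0 : TimeL2 H S)) ∈ Q := by
    set F : Submodule ℝ H := Q.comap (LinearMap.inl ℝ H (TimeL2 H S))
    have hFcl : IsClosed (F : Set H) :=
      hQcl.preimage (continuous_id.prodMk continuous_const)
    have htop : F = ⊤ := by
      rw [← hFcl.submodule_topologicalClosure_eq, Submodule.topologicalClosure_eq_top_iff,
        Submodule.eq_bot_iff]
      intro q hq
      have hmem : formResolvent i q ∈ F := by
        have hz : MemLp (0 : ℝ → H) 2 (volume.restrict (Icc 0 S)) := MemLp.zero'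
        have := Q.sub_mem (hreg q 0 hz) (hF ((memLp_regularSource i κ q hS.le hz).toLp _))
        rw [Prod.mk_sub_mk, sub_zero, sub_self] at this
        exact this
      have h0 := (Submodule.mem_orthogonal F q).1 hq _ hmem
      have h1 : ContinuousLinearMap.adjoint i q = 0 := by
        rw [← inner_self_eq_zero (𝕜 := ℝ), ← h0, formResolvent, ContinuousLinearMap.comp_apply,
          ContinuousLinearMap.adjoint_inner_right]
      refine hi q fun w => ?_
      rw [← ContinuousLinearMap.adjoint_inner_left, h1, inner_zero_left]
    intro y
    have : y ∈ F := htop ▸ Submodule.mem_top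
    exact this
  have hmem : (y₀, f) ∈ Q := by simpa using Q.add_mem (hI y₀) (hF f)
  exact hmem

include hG in
/-- Existence of weak solutions, together with their duality with the solutions of the adjoint
equation. -/
theorem exists_isFormSolution [CompleteSpace K] (hi : ∀ q : H, (∀ w, inner ℝ q (i w) = 0) → q = 0)
    {κ S : ℝ} (hκ : 0 < κ) (hS : 0 < S) (y₀ : H) {f : ℝ → H}
    (hf : MemLp f 2 (volume.restrict (Icc 0 S))) :
    ∃ (y : ℝ → H) (Y : ℝ → W), IsFormSolution i G κ S f y Y ∧ y 0 = y₀ ∧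
      ∀ (p : ℝ → H) (P : ℝ → W), IsFormSolution i G (-κ) S (fun _ => 0) p P → ∀ t ∈ Icc 0 S,
        inner ℝ (p t) (y t) - inner ℝ (p 0) (y 0) = ∫ s in (0 : ℝ)..t, (inner ℝ (p s) (f s) : ℝ) := by
  obtain ⟨e, he, he2⟩ := exists_mem_closure_regularSolutions hG hi hκ hS y₀ (hf.toLp f)
  have h0 : (0 : ℝ) ∈ Icc 0 S := ⟨le_rfl, hS.le⟩
  -- Each property of the solution is stated as membership in a closed set, so it only has to be
  -- checked on regular solutions.
  have hclosed : ∀ A : Set (SolutionSpace H W S), IsClosed A →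
      (∀ e ∈ regularSolutions i κ S, e ∈ A) → e ∈ A :=
    fun A hA h => closure_minimal h hA he
  have hy : ∀ t (ht : t ∈ Icc 0 S), IccExtend hS.le e.1.1 t = e.1.1 ⟨t, ht⟩ :=
    fun t ht => IccExtend_of_mem _ _ ht
  have hev : ∀ t : Icc (0 : ℝ) S, Continuous fun e : SolutionSpace H W S => e.1.1 t :=
    fun t => (continuous_eval_const t).comp (continuous_fst.comp continuous_fst)
  have hfae : e.2.2 =ᵐ[volume.restrict (Icc 0 S)] f := by
    rw [he2]
    exact hf.coeFn_toLp
  have hinit : e.1.1 ⟨0, h0⟩ = y₀ := by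
    have : e.1.1 ⟨0, h0⟩ = e.2.1 :=
      hclosed {e | e.1.1 ⟨0, h0⟩ = e.2.1} (isClosed_eq (hev _) (continuous_fst.comp continuous_snd))
        (by
          rintro e ⟨u₀, g, hg, h1, h2, h3, h4⟩
          simp only [mem_ofPred_eq]
          rw [h1, h3, primitive_zero])
    rw [this, he2]
  refine ⟨IccExtend hS.le e.1.1, e.1.2, ⟨?_, Lp.memLp _, ?_, ?_⟩, ?_, ?_⟩
  · exact (e.1.1.continuous.Icc_extend' (h := hS.le)).continuousOn
  · have : i.compLpL 2 (volume.restrict (Icc 0 S)) e.1.2 = continuousToTimeL2 hS.le e.1.1 := by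
      refine hclosed {e | i.compLpL 2 (volume.restrict (Icc 0 S)) e.1.2
        = continuousToTimeL2 hS.le e.1.1} (isClosed_eq
        ((ContinuousLinearMap.continuous _).comp (continuous_snd.comp continuous_fst))
        ((ContinuousLinearMap.continuous _).comp (continuous_fst.comp continuous_fst))) ?_
      rintro e ⟨u₀, g, hg, h1, h2, h3, h4⟩
      refine Lp.ext ?_
      filter_upwards [i.coeFn_compLpL e.1.2, coeFn_continuousToTimeL2 hS.le e.1.1, h2,
        ae_restrict_mem measurableSet_Icc] with t a1 a2 a3 ht
      rw [a1, a2, a3, IccExtend_of_mem _ _ ht, h1]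
      rfl
    filter_upwards [i.coeFn_compLpL e.1.2, coeFn_continuousToTimeL2 hS.le e.1.1] with t a1 a2
    rw [← a1, ← a2, this]
  · intro w t ht
    -- The fixed vectors `i w` and `G† G w` stand on the left, so that each integral is a continuous
    -- functional of a component of `e`.
    have := hclosed {e | inner ℝ (i w) (e.1.1 ⟨t, ht⟩) - inner ℝ (i w) (e.1.1 ⟨0, h0⟩)
        + κ * (∫ s in (0 : ℝ)..t, inner ℝ (ContinuousLinearMap.adjoint G (G w)) (e.1.2 s))
        = ∫ s in (0 : ℝ)..t, inner ℝ (i w) (e.2.2 s)} ?_ ?_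
    · simp only [mem_ofPred_eq] at this
      rw [intervalIntegral_inner_congr ht hfae] at this
      rw [hy t ht, hy 0 h0]
      simpa only [ContinuousLinearMap.adjoint_inner_left, real_inner_comm] using this
    · refine isClosed_eq (((continuous_const.inner (hev _)).sub
        (continuous_const.inner (hev _))).add (continuous_const.mul
        ((continuous_intervalIntegral_inner (memLp_const _) ht).comp
          (continuous_snd.comp continuous_fst))))
        ((continuous_intervalIntegral_inner (memLp_const _) ht).comp
          (continuous_snd.comp continuous_snd))
    · rintro e ⟨u₀, g, hg, h1, h2, h3, h4⟩
      have hw := (isFormSolution_formResolvent κ u₀ hG hS.le hg).weak_eq w t ht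
      simp only [mem_ofPred_eq]
      rw [h1, h1, intervalIntegral_inner_congr ht h2, intervalIntegral_inner_congr ht h4]
      simpa only [ContinuousLinearMap.adjoint_inner_left, real_inner_comm] using hw
  · rw [hy 0 h0, hinit]
  · intro p P hp t ht
    have := hclosed {e | inner ℝ (p t) (e.1.1 ⟨t, ht⟩) - inner ℝ (p 0) (e.1.1 ⟨0, h0⟩)
        = ∫ s in (0 : ℝ)..t, inner ℝ (p s) (e.2.2 s)} ?_ ?_
    · simp only [mem_ofPred_eq] at this
      rw [intervalIntegral_inner_congr ht hfae] at this
      rw [hy t ht, hy 0 h0]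
      exact this
    · exact isClosed_eq ((continuous_const.inner (hev _)).sub (continuous_const.inner (hev _)))
        ((continuous_intervalIntegral_inner hp.continuousOn.memLp_two_Icc ht).comp
          (continuous_snd.comp continuous_snd))
    · rintro e ⟨u₀, g, hg, h1, h2, h3, h4⟩
      have hw := duality_formResolvent κ u₀ hG hS.le hg hp ht
      simp only [mem_ofPred_eq]
      rw [h1, h1, intervalIntegral_inner_congr ht h4, ← hw, primitive_zero]

end Existence

/-! ### Change of source, restriction in time and superposition. -/

section FormSolutionOperations

variable {H W K : Type*} [NormedAddCommGroup H] [InnerProductSpace ℝ H]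
  [NormedAddCommGroup W] [InnerProductSpace ℝ W]
  [NormedAddCommGroup K] [InnerProductSpace ℝ K]
  {i : W →L[ℝ] H} {G : W →L[ℝ] K} {κ S : ℝ} {f f' y y' : ℝ → H} {Y Y' : ℝ → W}

theorem intervalIntegral_inner_congr_left {t : ℝ} (ht : t ∈ Icc 0 S) {f g : ℝ → H}
    (h : f =ᵐ[volume.restrict (Icc 0 S)] g) (q : ℝ → H) :
    ∫ s in (0 : ℝ)..t, (inner ℝ (f s) (q s) : ℝ) = ∫ s in (0 : ℝ)..t, inner ℝ (g s) (q s) := by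
  simpa only [real_inner_comm] using intervalIntegral_inner_congr ht h q

theorem IsFormSolution.congr_source (h : IsFormSolution i G κ S f y Y)
    (hf : f =ᵐ[volume.restrict (Icc 0 S)] f') : IsFormSolution i G κ S f' y Y := by
  refine ⟨h.continuousOn, h.memLp, h.ae_eq, fun w t ht => ?_⟩
  rw [h.weak_eq w t ht]
  exact intervalIntegral_inner_congr_left ht hf (fun _ => i w)

theorem IsFormSolution.mono (h : IsFormSolution i G κ S f y Y) {R : ℝ} (hR : R ≤ S) :
    IsFormSolution i G κ R f y Y := by
  have hsub : Icc 0 R ⊆ Icc 0 S := Icc_subset_Icc_right hR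
  exact ⟨h.continuousOn.mono hsub, h.memLp.mono_measure (Measure.restrict_mono hsub le_rfl),
    ae_restrict_of_ae_restrict_of_subset hsub h.ae_eq, fun w t ht => h.weak_eq w t (hsub ht)⟩

theorem IsFormSolution.add_smul [CompleteSpace H] [CompleteSpace K]
    (h : IsFormSolution i G κ S f y Y) (h' : IsFormSolution i G κ S f' y' Y')
    (hf : MemLp f 2 (volume.restrict (Icc 0 S))) (hf' : MemLp f' 2 (volume.restrict (Icc 0 S)))
    (c : ℝ) :
    IsFormSolution i G κ S (fun t => f t + c • f' t) (fun t => y t + c • y' t)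
      (fun t => Y t + c • Y' t) := by
  refine ⟨h.continuousOn.add (h'.continuousOn.const_smul c),
    h.memLp.add (h'.memLp.const_smul c), ?_, fun w t ht => ?_⟩
  · filter_upwards [h.ae_eq, h'.ae_eq] with t h1 h2
    rw [map_add, map_smul, h1, h2]
  · have e := h.weak_eq w t ht
    have e' := h'.weak_eq w t ht
    have m1 := (h.memLp.continuousLinearMap_comp G).intervalIntegrable_of_mem_Icc ht
    have m2 := (h'.memLp.continuousLinearMap_comp G).intervalIntegrable_of_mem_Icc ht
    have m3 : IntervalIntegrable (fun s => c • G (Y' s)) volume 0 t := m2.smul c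
    have n1 := hf.intervalIntegrable_of_mem_Icc ht
    have n2 := hf'.intervalIntegrable_of_mem_Icc ht
    have n3 : IntervalIntegrable (fun s => c • f' s) volume 0 t := n2.smul c
    rw [intervalIntegral_inner_right ht.1 m1, intervalIntegral_inner_right ht.1 n1] at e
    rw [intervalIntegral_inner_right ht.1 m2, intervalIntegral_inner_right ht.1 n2] at e'
    simp only [map_add, map_smul]
    rw [intervalIntegral_inner_right ht.1 (m1.add m3), intervalIntegral_inner_right ht.1 (n1.add n3),
      intervalIntegral.integral_add m1 m3, intervalIntegral.integral_add n1 n3,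
      intervalIntegral.integral_smul, intervalIntegral.integral_smul]
    simp only [inner_add_left, real_inner_smul_left]
    linear_combination e + c * e'

end FormSolutionOperations

/-! ### The heat equation as an instance of the abstract setting. -/

section Heat

variable {d : ℕ} {Ω Ωc : Set (EuclideanSpace ℝ (Fin d))} {V : Submodule ℝ (GradPair Ω)}

/-- The embedding of the energy space into `L²(Ω)`. -/
noncomputable def energyEmbedding (V : Submodule ℝ (GradPair Ω)) : V →L[ℝ] L2 Ω :=
  (WithLp.fstL 2 ℝ (L2 Ω) (L2Vec Ω)) ∘L V.subtypeL

/-- The gradient on the energy space. -/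
noncomputable def energyGradient (V : Submodule ℝ (GradPair Ω)) : V →L[ℝ] L2Vec Ω :=
  (WithLp.sndL 2 ℝ (L2 Ω) (L2Vec Ω)) ∘L V.subtypeL

theorem inner_energyEmbedding_add_inner_energyGradient (a b : V) :
    (inner ℝ (energyEmbedding V a) (energyEmbedding V b) : ℝ)
      + inner ℝ (energyGradient V a) (energyGradient V b) = inner ℝ a b :=
  rfl

/-- `V` contains the test functions, so `q` vanishes almost everywhere in the interior; the rest of
`Ω` lies in its null frontier. Compactness makes the measure finite, hence `q` integrable. -/
theorem IsEnergySpace.eq_zero_of_inner_eq_zero (hV : IsEnergySpace Ω V) (hΩ : IsCompact Ω)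
    (hfr : volume (frontier Ω) = 0) (q : L2 Ω) (hq : ∀ w : V, inner ℝ q (energyEmbedding V w) = 0) :
    q = 0 := by
  have hfin : IsFiniteMeasure (volume.restrict Ω) := ⟨by simpa using hΩ.measure_lt_top⟩
  have hqi : Integrable q (volume.restrict Ω) := (Lp.memLp q).integrable one_le_two
  have h0 := isOpen_interior.ae_eq_zero_of_integral_contDiff_smul_eq_zero (U := interior Ω)
    (hqi.locallyIntegrable.locallyIntegrableOn _) (fun φ h1 h2 h3 => by
      obtain ⟨U, hU, hφ, -⟩ := hV.testFunction_mem φ ⟨h1, h2, h3⟩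
      have : (inner ℝ q U.fst : ℝ) = 0 := hq ⟨U, hU⟩
      rw [L2.inner_def] at this
      rw [← this]
      refine integral_congr_ae (hφ.mono fun x hx => ?_)
      simp [hx])
  have hint : ∀ᵐ x ∂(volume.restrict Ω), x ∈ interior Ω := by
    have hnf : ∀ᵐ x ∂(volume.restrict Ω), x ∉ frontier Ω :=
      ae_restrict_of_ae (measure_eq_zero_iff_ae_notMem.1 hfr)
    filter_upwards [hnf, ae_restrict_mem hΩ.measurableSet] with x h1 h2
    by_contra h3
    exact h1 ⟨subset_closure h2, h3⟩
  rw [Lp.eq_zero_iff_ae_eq_zero]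
  filter_upwards [h0, hint] with x h1 h2 using h1 h2

theorem isWeakSolution_iff (hV : IsEnergySpace Ω V) {κ S : ℝ} {f y : ℝ → L2 Ω} :
    IsWeakSolution V κ S f y ↔
      ∃ Y, IsFormSolution (energyEmbedding V) (energyGradient V) κ S f y Y := by
  have : CompleteSpace V := hV.isClosed.completeSpace_coe
  constructor
  · rintro ⟨hc, Y, hY, hae, heq⟩
    have hP : ∀ᵐ t ∂(volume.restrict (Icc 0 S)),
        (V.orthogonalProjectionOnto (Y t) : GradPair Ω) = Y t :=
      hae.mono fun t ht => V.starProjection_eq_self_iff.2 ht.1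
    -- `Y t` lies in `V` only for almost every `t`; the orthogonal projection gives a `V`-valued
    -- function that agrees with it almost everywhere.
    refine ⟨fun t => V.orthogonalProjectionOnto (Y t), hc, hY.continuousLinearMap_comp _, ?_, ?_⟩
    · filter_upwards [hP, hae] with t h1 h2
      rw [← h2.2]
      exact congrArg WithLp.fst h1
    · intro w t ht
      refine Eq.trans ?_ (heq w w.2 t ht)
      have := intervalIntegral_inner_congr_left ht (f := fun s => energyGradient V
        (V.orthogonalProjectionOnto (Y s))) (g := fun s => (Y s).snd)
        (hP.mono fun s hs => congrArg WithLp.snd hs) (fun _ => energyGradient V w)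
      exact congrArg (fun z => inner ℝ (y t) (w : GradPair Ω).fst
        - inner ℝ (y 0) (w : GradPair Ω).fst + κ * z) this
  · rintro ⟨Y, h⟩
    refine ⟨h.continuousOn, fun t => Y t, h.memLp.continuousLinearMap_comp V.subtypeL, ?_, ?_⟩
    · filter_upwards [h.ae_eq] with t ht using ⟨(Y t).2, ht⟩
    · exact fun w hw t ht => h.weak_eq ⟨w, hw⟩ t ht

theorem coeFn_injection (Ω : Set (EuclideanSpace ℝ (Fin d))) (hc : MeasurableSet Ωc) (u : L2 Ωc) :
    injection Ω hc u =ᵐ[volume.restrict Ω] Ωc.indicator u :=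
  MemLp.coeFn_toLp _

/-- Extension by zero as a continuous linear map. -/
noncomputable def injectionCLM (Ω : Set (EuclideanSpace ℝ (Fin d))) (hc : MeasurableSet Ωc) :
    L2 Ωc →L[ℝ] L2 Ω :=
  LinearMap.mkContinuous
    { toFun := injection Ω hc
      map_add' := fun u v => by
        have huv := (ae_restrict_iff' hc).1 (Lp.coeFn_add u v)
        refine Lp.ext ?_
        filter_upwards [coeFn_injection Ω hc (u + v), coeFn_injection Ω hc u,
          coeFn_injection Ω hc v, Lp.coeFn_add (injection Ω hc u) (injection Ω hc v),
          ae_restrict_of_ae huv] with x h1 h2 h3 h4 h5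
        rw [h1, h4, Pi.add_apply, h2, h3]
        by_cases hx : x ∈ Ωc
        · simp only [indicator_of_mem hx, h5 hx, Pi.add_apply]
        · simp [hx]
      map_smul' := fun c u => by
        have hu := (ae_restrict_iff' hc).1 (Lp.coeFn_smul c u)
        refine Lp.ext ?_
        filter_upwards [coeFn_injection Ω hc (c • u), coeFn_injection Ω hc u,
          Lp.coeFn_smul c (injection Ω hc u), ae_restrict_of_ae hu] with x h1 h2 h4 h5
        rw [h1, RingHom.id_apply, h4, Pi.smul_apply, h2]
        by_cases hx : x ∈ Ωc
        · simp only [indicator_of_mem hx, h5 hx, Pi.smul_apply]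
        · simp [hx] }
    1 (fun u => by
      rw [one_mul]
      refine (Lp.norm_toLp (Ωc.indicator u)
        (((memLp_indicator_iff_restrict hc).2 (Lp.memLp u)).restrict Ω)).trans_le ?_
      rw [Lp.norm_def]
      refine ENNReal.toReal_mono (Lp.eLpNorm_ne_top u) ?_
      refine (eLpNorm_mono_measure _ Measure.restrict_le_self).trans_eq ?_
      exact eLpNorm_indicator_eq_eLpNorm_restrict hc)

theorem memLp_injection (hc : MeasurableSet Ωc) {S : ℝ} (v : Control Ωc S) :
    MemLp (fun t => injection Ω hc (v t)) 2 (volume.restrict (Icc 0 S)) :=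
  (Lp.memLp v).continuousLinearMap_comp (injectionCLM Ω hc)

end Heat

/-! ### Optimality conditions of the full and the restricted problem. -/

section OptimalControl

/-- The polynomial is minimal at `ε = 0`, where its derivative is `L`. -/
theorem eq_zero_of_forall_le_mul_add_sq {L q : ℝ} (h : ∀ ε : ℝ, 0 ≤ ε * L + ε ^ 2 * q) : L = 0 := by
  have hd : HasDerivAt (fun ε : ℝ => ε * L + ε ^ 2 * q) L 0 := by
    have := ((hasDerivAt_id (0 : ℝ)).mul_const L).add (((hasDerivAt_id (0 : ℝ)).pow 2).mul_const q)
    exact this.congr_deriv (by simp)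
  refine IsLocalMin.hasDerivAt_eq_zero (Filter.Eventually.of_forall fun ε => ?_) hd
  simpa using h ε

variable {d : ℕ} {Ω Ωc : Set (EuclideanSpace ℝ (Fin d))} {V : Submodule ℝ (GradPair Ω)}
  {ν S : ℝ} {y₀ : L2 Ω}

theorem IsState.eqOn (hV : IsEnergySpace Ω V) {hc : MeasurableSet Ωc} (hν : 0 < ν) (hS : 0 < S)
    {w : Control Ωc S} {x x' : ℝ → L2 Ω} (h : IsState V hc ν y₀ S w x)
    (h' : IsState V hc ν y₀ S w x') : EqOn x x' (Icc 0 S) := by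
  obtain ⟨X, hX⟩ := (isWeakSolution_iff hV).1 h.1
  obtain ⟨X', hX'⟩ := (isWeakSolution_iff hV).1 h'.1
  exact hX.eqOn hν hS hX' (h.2.trans h'.2.symm)

/-- Controls have states, and these satisfy the duality relation with the adjoint states. -/
theorem exists_isState (hV : IsEnergySpace Ω V) (hΩ : IsCompact Ω) (hfr : volume (frontier Ω) = 0)
    (hc : MeasurableSet Ωc) (hν : 0 < ν) (hS : 0 < S) (y₀ : L2 Ω) (w : Control Ωc S) :
    ∃ x : ℝ → L2 Ω, IsState V hc ν y₀ S w x ∧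
      ∀ p : ℝ → L2 Ω, IsWeakSolution V (-ν) S (fun _ => 0) p → ∀ t ∈ Icc 0 S,
        inner ℝ (p t) (x t) - inner ℝ (p 0) y₀
          = ∫ s in (0 : ℝ)..t, (inner ℝ (p s) (injection Ω hc (w s)) : ℝ) := by
  have : CompleteSpace V := hV.isClosed.completeSpace_coe
  obtain ⟨x, X, hX, hx0, hdual⟩ := exists_isFormSolution
    inner_energyEmbedding_add_inner_energyGradient (hV.eq_zero_of_inner_eq_zero hΩ hfr) hν hS y₀
    (memLp_injection (Ω := Ω) hc w)
  refine ⟨x, ⟨(isWeakSolution_iff hV).2 ⟨X, hX⟩, hx0⟩, fun p hp t ht => ?_⟩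
  obtain ⟨P, hP⟩ := (isWeakSolution_iff hV).1 hp
  rw [← hdual p P hP t ht, hx0]

theorem IsState.add_smul (hV : IsEnergySpace Ω V) {hc : MeasurableSet Ωc} {x₀ : L2 Ω}
    {v h : Control Ωc S} {y x : ℝ → L2 Ω} (hy : IsState V hc ν y₀ S v y)
    (hx : IsState V hc ν x₀ S h x) (c : ℝ) :
    IsState V hc ν (y₀ + c • x₀) S (v + c • h) (fun t => y t + c • x t) := by
  obtain ⟨Y, hY⟩ := (isWeakSolution_iff hV).1 hy.1
  obtain ⟨X, hX⟩ := (isWeakSolution_iff hV).1 hx.1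
  refine ⟨(isWeakSolution_iff hV).2 ⟨_, (hY.add_smul hX (memLp_injection hc v)
    (memLp_injection hc h) c).congr_source ?_⟩, by simp only [hy.2, hx.2]⟩
  filter_upwards [Lp.coeFn_add v (c • h), Lp.coeFn_smul c h] with t h1 h2
  rw [h1, Pi.add_apply, h2, Pi.smul_apply]
  exact (((injectionCLM Ω hc).map_add _ _).trans
    (congrArg _ ((injectionCLM Ω hc).map_smul _ _))).symm

theorem IsState.mono (hV : IsEnergySpace Ω V) {hc : MeasurableSet Ωc} {R : ℝ} (hR : R ≤ S)
    {v : Control Ωc S} {y : ℝ → L2 Ω} (hy : IsState V hc ν y₀ S v y) {w : Control Ωc R}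
    (hw : w =ᵐ[volume.restrict (Icc 0 R)] v) : IsState V hc ν y₀ R w y := by
  obtain ⟨Y, hY⟩ := (isWeakSolution_iff hV).1 hy.1
  refine ⟨(isWeakSolution_iff hV).2 ⟨Y, (hY.mono hR).congr_source (hw.mono fun t ht => ?_)⟩, hy.2⟩
  simp only [ht]

theorem Control.coeFn_restrict {R : ℝ} (hR : R ≤ S) (v : Control Ωc S) :
    Control.restrict hR v =ᵐ[volume.restrict (Icc 0 R)] v :=
  MemLp.coeFn_toLp _

theorem memLp_indicator_control {R : ℝ} (h : Control Ωc R) :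
    MemLp ((Icc 0 R).indicator h) 2 (volume.restrict (Icc 0 S)) :=
  ((memLp_indicator_iff_restrict measurableSet_Icc).2 (Lp.memLp h)).restrict _

/-- The first-order optimality condition. -/
theorem IsOptimalControl.inner_add_inner_eq_zero (hV : IsEnergySpace Ω V) {hc : MeasurableSet Ωc}
    (hν : 0 < ν) (hS : 0 < S) {α : ℝ} {z : L2 Ω} {v : Control Ωc S} {y : ℝ → L2 Ω}
    (hv : IsOptimalControl V hc ν α y₀ S z v) (hy : IsState V hc ν y₀ S v y)
    {h : Control Ωc S} {x : ℝ → L2 Ω} (hx : IsState V hc ν 0 S h x) :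
    (inner ℝ (y S - z) (x S) : ℝ) + α * inner ℝ v h = 0 := by
  obtain ⟨y', hy', hmin⟩ := hv
  have hyS : y' S = y S := hy'.eqOn hV hν hS hy ⟨hS.le, le_rfl⟩
  refine eq_zero_of_forall_le_mul_add_sq (q := ‖x S‖ ^ 2 / 2 + α / 2 * ‖h‖ ^ 2) fun ε => ?_
  -- As `x` starts from `0`, the perturbed control keeps the initial value `y₀`, and the excess of
  -- its cost is a quadratic polynomial in `ε`.
  have hst := hy.add_smul hV hx ε
  rw [smul_zero, add_zero] at hst
  have hle := hmin _ _ hst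
  simp only [cost, hyS] at hle
  have e1 : ‖y S + ε • x S - z‖ ^ 2
      = ‖y S - z‖ ^ 2 + 2 * (ε * inner ℝ (y S - z) (x S)) + ε ^ 2 * ‖x S‖ ^ 2 := by
    rw [add_sub_right_comm, norm_add_sq_real, real_inner_smul_right, norm_smul, mul_pow,
      Real.norm_eq_abs, sq_abs]
  have e2 : ‖v + ε • h‖ ^ 2 = ‖v‖ ^ 2 + 2 * (ε * inner ℝ v h) + ε ^ 2 * ‖h‖ ^ 2 := by
    rw [norm_add_sq_real, real_inner_smul_right, norm_smul, mul_pow, Real.norm_eq_abs, sq_abs]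
  rw [e1, e2] at hle
  linarith

/-- The optimality condition of the restricted problem. -/
theorem exists_isState_inner_adjoint_add_inner_restrict (hV : IsEnergySpace Ω V)
    (hΩ : IsCompact Ω) (hfr : volume (frontier Ω) = 0) {hc : MeasurableSet Ωc} (hν : 0 < ν)
    {α τ T : ℝ} (hτ : 0 < τ) (hτT : τ ≤ T) {z : L2 Ω} {v : Control Ωc T} {y p : ℝ → L2 Ω}
    (hv : IsOptimalControl V hc ν α y₀ T z v) (hy : IsState V hc ν y₀ T v y)
    (hp : IsAdjointState V ν T (y T - z) p) (h : Control Ωc τ) :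
    ∃ x : ℝ → L2 Ω, IsState V hc ν 0 τ h x ∧
      (inner ℝ (p τ) (x τ) : ℝ) + α * inner ℝ (Control.restrict hτT v) h = 0 := by
  have hT : 0 < T := hτ.trans_le hτT
  have hsub : Icc 0 τ ⊆ Icc 0 T := Icc_subset_Icc_right hτT
  have hm : MemLp ((Icc 0 τ).indicator h) 2 (volume.restrict (Icc 0 T)) :=
    memLp_indicator_control h
  set k : Control Ωc T := hm.toLp _
  have hkT : k =ᵐ[volume.restrict (Icc 0 T)] (Icc 0 τ).indicator h := hm.coeFn_toLp
  have hkτ : h =ᵐ[volume.restrict (Icc 0 τ)] k := by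
    filter_upwards [ae_restrict_of_ae_restrict_of_subset hsub hkT,
      ae_restrict_mem measurableSet_Icc] with t h1 h2
    rw [h1, indicator_of_mem h2]
  obtain ⟨x, hx, hdual⟩ := exists_isState hV hΩ hfr hc hν hT 0 k
  refine ⟨x, hx.mono hV hτT hkτ, ?_⟩
  -- The control `k` vanishes after `τ`, so the duality relation makes `(p, x)` take the same value
  -- at `τ` and at `T`.
  have hpx : (inner ℝ (p τ) (x τ) : ℝ) = inner ℝ (p T) (x T) := by
    have d1 := hdual p hp.1 τ ⟨hτ.le, hτT⟩
    have d2 := hdual p hp.1 T ⟨hT.le, le_rfl⟩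
    rw [inner_zero_right, sub_zero] at d1 d2
    rw [d1, d2, intervalIntegral.integral_of_le hτ.le, intervalIntegral.integral_of_le hT.le]
    refine (setIntegral_eq_of_subset_of_ae_sdiff_eq_zero measurableSet_Ioc.nullMeasurableSet
      (Ioc_subset_Ioc_right hτT) ?_).symm
    filter_upwards [(ae_restrict_iff' measurableSet_Icc).1 hkT] with t ht htm
    have h0 : k t = 0 := by
      rw [ht (Ioc_subset_Icc_self htm.1)]
      exact indicator_of_notMem (fun hmem => htm.2 ⟨htm.1.1, hmem.2⟩) _
    have hB : injection Ω hc (0 : L2 Ωc) = 0 := (injectionCLM Ω hc).map_zero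
    rw [h0, hB, inner_zero_right]
  have hvk : (inner ℝ (Control.restrict hτT v) h : ℝ) = inner ℝ v k := by
    rw [L2.inner_def, L2.inner_def]
    have e : ∫ t in Icc 0 τ, (inner ℝ (Control.restrict hτT v t) (h t) : ℝ)
        = ∫ t in Icc 0 τ, inner ℝ (v t) (k t) := by
      refine integral_congr_ae ?_
      filter_upwards [Control.coeFn_restrict hτT v, hkτ] with t h1 h2
      rw [h1, h2]
    rw [e]
    refine (setIntegral_eq_of_subset_of_ae_sdiff_eq_zero measurableSet_Icc.nullMeasurableSet
      hsub ?_).symm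
    filter_upwards [(ae_restrict_iff' measurableSet_Icc).1 hkT] with t ht htm
    rw [ht htm.1, indicator_of_notMem htm.2, inner_zero_right]
  rw [hpx, hvk, hp.2]
  exact hv.inner_add_inner_eq_zero hV hν hT hy hx

/-- The excess of the cost of the restricted problem over its value at the restricted control. -/
theorem exists_isState_cost_eq (hV : IsEnergySpace Ω V)
    (hΩ : IsCompact Ω) (hfr : volume (frontier Ω) = 0) {hc : MeasurableSet Ωc} (hν : 0 < ν)
    {α τ T : ℝ} (hτ : 0 < τ) (hτT : τ ≤ T) {z : L2 Ω} {v : Control Ωc T} {y p : ℝ → L2 Ω}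
    (hv : IsOptimalControl V hc ν α y₀ T z v) (hy : IsState V hc ν y₀ T v y)
    (hp : IsAdjointState V ν T (y T - z) p) (w : Control Ωc τ) :
    ∃ (x : ℝ → L2 Ω) (r : ℝ), 0 ≤ r ∧ IsState V hc ν y₀ τ w x ∧
      cost α τ (targetTrajectory y p τ) w x
        = cost α τ (targetTrajectory y p τ) (Control.restrict hτT v) y
          + (r + α / 2 * ‖w - Control.restrict hτT v‖ ^ 2) := by
  obtain ⟨x, hx, horth⟩ := exists_isState_inner_adjoint_add_inner_restrict hV hΩ hfr hν hτ hτT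
    hv hy hp (w - Control.restrict hτT v)
  have hyτ : IsState V hc ν y₀ τ (Control.restrict hτT v) y :=
    hy.mono hV hτT (Control.coeFn_restrict hτT v)
  -- By superposition, the state of `w` is `y + x`, with `x` the state of `w - v` from initial value
  -- `0`.
  have hst := hyτ.add_smul hV hx 1
  rw [smul_zero, add_zero, one_smul, add_sub_cancel] at hst
  refine ⟨_, 1 / 2 * ‖x τ‖ ^ 2, by positivity, hst, ?_⟩
  have e1 : ‖y τ + (1 : ℝ) • x τ - targetTrajectory y p τ‖ ^ 2
      = ‖p τ‖ ^ 2 + 2 * inner ℝ (p τ) (x τ) + ‖x τ‖ ^ 2 := by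
    rw [← norm_add_sq_real]
    congr 2
    simp only [targetTrajectory, one_smul]
    abel
  -- The misfit of the restricted control is `p τ`, so the cross terms in `e1` and `e3` cancel by
  -- `horth`.
  have e2 : ‖y τ - targetTrajectory y p τ‖ ^ 2 = ‖p τ‖ ^ 2 := by
    simp only [targetTrajectory, sub_sub_cancel]
  have e3 : ‖w‖ ^ 2 = ‖Control.restrict hτT v‖ ^ 2
      + 2 * inner ℝ (Control.restrict hτT v) (w - Control.restrict hτT v)
      + ‖w - Control.restrict hτT v‖ ^ 2 := by
    rw [← norm_add_sq_real, add_sub_cancel]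
  simp only [cost]
  rw [e1, e2, e3]
  linear_combination horth

end OptimalControl

/-! ### The restricted problem and its unique minimizer. -/

theorem lemma1 {d : ℕ}
    (Ω Ωc : Set (EuclideanSpace ℝ (Fin d)))
    (hΩ : IsCompact Ω) (hfr : volume (frontier Ω) = 0)
    (hc : MeasurableSet Ωc) (hcΩ : Ωc ⊆ Ω)
    (V : Submodule ℝ (GradPair Ω)) (hV : IsEnergySpace Ω V)
    (ν α T τ : ℝ) (hν : 0 < ν) (hα : 0 < α) (hτ : 0 < τ) (hτT : τ < T)
    (y₀ y_target : L2 Ω)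
    (v : Control Ωc T) (y p : ℝ → L2 Ω)
    (hv : IsOptimalControl V hc ν α y₀ T y_target v)
    (hy : IsState V hc ν y₀ T v y)
    (hp : IsAdjointState V ν T (y T - y_target) p) :
    -- every control on `[0, τ]` has exactly one state on `[0, τ]`
    (∀ w : Control Ωc τ,
      (∃ x : ℝ → L2 Ω, IsState V hc ν y₀ τ w x) ∧
      ∀ x x' : ℝ → L2 Ω, IsState V hc ν y₀ τ w x → IsState V hc ν y₀ τ w x' →
        EqOn x x' (Icc 0 τ)) ∧
    -- the restriction of `v` is the one and only minimizer of the problem on `[0, τ]`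
    ∀ w : Control Ωc τ,
      IsOptimalControl V hc ν α y₀ τ (targetTrajectory y p τ) w ↔ w = Control.restrict hτT.le v := by
  have hyτ : IsState V hc ν y₀ τ (Control.restrict hτT.le v) y :=
    hy.mono hV hτT.le (Control.coeFn_restrict hτT.le v)
  have hcost : ∀ (w : Control Ωc τ) (x : ℝ → L2 Ω), IsState V hc ν y₀ τ w x →
      ∃ r : ℝ, 0 ≤ r ∧ cost α τ (targetTrajectory y p τ) w x
        = cost α τ (targetTrajectory y p τ) (Control.restrict hτT.le v) y
          + (r + α / 2 * ‖w - Control.restrict hτT.le v‖ ^ 2) := by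
    intro w x hx
    obtain ⟨x', r, hr, hx', h⟩ := exists_isState_cost_eq hV hΩ hfr hν hτ hτT.le hv hy hp w
    refine ⟨r, hr, ?_⟩
    -- The cost sees a state only through its value at `τ`, and uniqueness lets any state `x`
    -- replace the constructed `x'`.
    rw [← h, cost, cost, hx.eqOn hV hν hτ hx' ⟨hτ.le, le_rfl⟩]
  refine ⟨fun w => ⟨?_, fun x x' hx hx' => hx.eqOn hV hν hτ hx'⟩, fun w => ⟨?_, ?_⟩⟩
  · obtain ⟨x, hx, -⟩ := exists_isState hV hΩ hfr hc hν hτ y₀ w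
    exact ⟨x, hx⟩
  · rintro ⟨x, hx, hmin⟩
    obtain ⟨r, hr, h⟩ := hcost w x hx
    have hle := hmin _ y hyτ
    have h0 : ‖w - Control.restrict hτT.le v‖ ^ 2 ≤ 0 := by
      by_contra hpos
      have := mul_pos (half_pos hα) (not_le.1 hpos)
      linarith
    exact sub_eq_zero.1 (norm_eq_zero.1 (pow_eq_zero_iff two_ne_zero |>.1
      (le_antisymm h0 (sq_nonneg _))))
  · rintro rfl
    refine ⟨y, hyτ, fun w x hx => ?_⟩
    obtain ⟨r, hr, h⟩ := hcost w x hx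
    rw [h]
    have : 0 ≤ α / 2 * ‖w - Control.restrict hτT.le v‖ ^ 2 := by positivity
    linarith
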